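/- There are absolute constants $c_2,c_3,c_4$ such that the following holds for every finite digraph $G$ and every natural number $k$. For $p\in\{2,3,4\}$, suppose that $G$ does not contain a family of $k$ distinct directed cycles such that every vertex of $G$ lies on at most $p$ of them. Then the directed treewidth of $G$ satisfies: a) if $p=4$, then $\mathrm{dtw}(G)\le c_4\,k^3$; b) if $p=3$, then $\mathrm{dtw}(G)\le c_3\,k^4$; c) if $p=2$, then $\mathrm{dtw}(G)\le c_2\,k^5$. Here a directed cycle has no repeated vertices (cycles of length two, and loops if $G$ has any, count as cycles). An arboreal decomposition of $G$ is a triple $(R,X,W)$, where $R$ is a rooted tree with all arcs directed away from the root, $X$ assigns a set $X_e\subseteq V(G)$ to each arc $e$ of $R$, and $W$ assigns a set $W_t\subseteq V(G)$ to each node $t$ of $R$, such that the sets $W_t$ form a partition of $V(G)$ into nonempty sets and, for every arc $e=(s,t)$ of $R$, the union $S$ of the sets $W_{t'}$ over all nodes $t'$ reachable from $t$ in $R$ is disjoint from $X_e$ and no directed walk in $G-X_e$ starts and ends in $S$ and uses a vertex outside $S\cup X_e$. Its width is $\max_t \bigl|W_t\cup\bigcup_{e} X_e\bigr|-1$, where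 for each node $t$ the union is over the arcs $e$ of $R$ incident with $t$, and $\mathrm{dtw}(G)$ is the minimum width of an arboreal decomposition of $G$ (and $0$ if $G$ has no vertices). -/

import Mathlib

universe u

namespace Digraph

variable {V : Type u}

/-- A directed cycle of `G`: a nonempty cyclic sequence of pairwise distinct vertices in which
consecutive vertices (also the last and the first) are joined by an arc of `G`. Cycles of length
two are allowed, and a loop is a cycle of length one. Sequences that differ by a rotation are
the same `Cycle`. -/
def IsDirectedCycle (G : Digraph V) (C : Cycle V) : Prop :=
  C ≠ Cycle.nil ∧ C.Nodup ∧ C.Chain G.Adj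

/-- `G` contains a family of `k` (distinct) directed cycles such that every vertex of `G` lies on
at most `p` of them. -/
def HasCyclePacking (G : Digraph V) (p k : ℕ) : Prop :=
  ∃ F : Finset (Cycle V), F.card = k ∧ (∀ C ∈ F, G.IsDirectedCycle C) ∧
    ∀ v : V, {C : Cycle V | C ∈ F ∧ v ∈ C}.ncard ≤ p

/-- There is a directed walk (possibly of length zero) from `a` to `b` in `G`. -/
def Reach (G : Digraph V) (a b : V) : Prop :=
  Relation.ReflTransGen G.Adj a b

/-- The digraph `G - Z`; the deleted vertices are kept as isolated vertices. -/
def deleteVerts (G : Digraph V) (Z : Set V) : Digraph V where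
  Adj a b := G.Adj a b ∧ a ∉ Z ∧ b ∉ Z

/-- A set `S` of vertices disjoint from `Z` is `Z`-normal if no directed walk of `G - Z` starts
and ends in `S` and uses a vertex outside `S ∪ Z`. -/
def IsNormal (G : Digraph V) (Z S : Set V) : Prop :=
  Disjoint S Z ∧
    ∀ a ∈ S, ∀ c ∈ S, ∀ b, b ∉ S ∪ Z →
      ¬ ((G.deleteVerts Z).Reach a b ∧ (G.deleteVerts Z).Reach b c)

/-- `R` is an arborescence (rooted tree with all arcs directed away from the root) with root `r`:
the root has no incoming arc, every other node has exactly one, and every node can be reached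
from the root. -/
structure IsArborescence {T : Type u} (R : Digraph T) (r : T) : Prop where
  root_no_in : ∀ s, ¬ R.Adj s r
  unique_in : ∀ t, t ≠ r → ∃! s, R.Adj s t
  reach : ∀ t, R.Reach r t

/-- An arboreal decomposition `(R, X, W)` of `G` (Johnson, Robertson, Seymour, Thomas):
`R` is an arborescence, the sets `W t` form a partition of the vertex set into nonempty sets,
and for every arc `(s, t)` of `R` the union of the sets `W t'` over all nodes `t'` reachable from
`t` is `X s t`-normal. Only the values of `X` at arcs of `R` matter. -/
structure ArborealDecomposition (G : Digraph V) where
  /-- The nodes of the arborescence. -/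
  T : Type u
  /-- The arborescence. -/
  R : Digraph T
  /-- Its root. -/
  root : T
  isArborescence : R.IsArborescence root
  /-- The vertex sets attached to the nodes. -/
  W : T → Set V
  /-- The guards attached to the arcs. -/
  X : T → T → Set V
  nonempty : ∀ t, (W t).Nonempty
  partition : ∀ v, ∃! t, v ∈ W t
  normal : ∀ s t, R.Adj s t → G.IsNormal (X s t) {v | ∃ t', R.Reach t t' ∧ v ∈ W t'}

/-- `W t` together with the guards of all arcs of the arborescence that are incident with `t`. -/
def ArborealDecomposition.bag {G : Digraph V} (D : G.ArborealDecomposition) (t : D.T) : Set V :=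
  D.W t ∪ {v | ∃ s, D.R.Adj s t ∧ v ∈ D.X s t} ∪ {v | ∃ s, D.R.Adj t s ∧ v ∈ D.X t s}

/-- `D` has width at most `w`: every set `W t ∪ ⋃ X e`, with the union over the arcs `e` incident
with `t`, has at most `w + 1` elements. -/
def ArborealDecomposition.WidthLE [Finite V] {G : Digraph V} (D : G.ArborealDecomposition)
    (w : ℕ) : Prop :=
  ∀ t, (D.bag t).ncard ≤ w + 1

/-- The directed treewidth of a finite digraph: the least width of an arboreal decomposition.
(The digraph without vertices has no arboreal decomposition and gets the value `0`.) -/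
noncomputable def directedTreewidth [Finite V] (G : Digraph V) : ℕ :=
  sInf {w : ℕ | ∃ D : G.ArborealDecomposition, D.WidthLE w}

/-- Every finite digraph with a vertex has an arboreal decomposition of some width, so that the
infimum in `directedTreewidth` is attained. -/
theorem exists_arborealDecomposition [Finite V] [Nonempty V] (G : Digraph V) :
    ∃ w : ℕ, ∃ D : G.ArborealDecomposition, D.WidthLE w := by
  refine ⟨Nat.card V, ⟨PUnit, ⟨fun _ _ => False⟩, PUnit.unit,
    ⟨fun _ h => h, fun t ht => (ht rfl).elim, fun _ => Relation.ReflTransGen.refl⟩,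
    fun _ => Set.univ, fun _ _ => ∅, fun _ => Set.univ_nonempty,
    fun _ => ⟨PUnit.unit, trivial, fun _ _ => rfl⟩, fun _ _ h => h.elim⟩, fun t => ?_⟩
  exact (Set.ncard_le_card _).trans (Nat.le_succ _)

end Digraph

/-! The argument passes through brambles: pairwise intersecting, strongly connected vertex sets that
no small vertex set hits. If there is no bramble of order `n`, every vertex set has a balanced
separator of fewer than `n` vertices, and recursive splitting gives an arboreal decomposition of
width at most `3 * n` (`directedTreewidth_le_of_forall_not_isBramble`). It remains to find `k`
cycles in a bramble of order `O(k ^ 3)` with congestion 4, or of order `O(k ^ 4)` with congestion 2.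
The latter serves both `p = 3` and `p = 2`.

Some path meets every bramble set. It is cut into `2 * r` pieces, each hard to separate from the
bramble. Matroid intersection selects in each piece `d` vertices that are highly linked both to and
from the bramble, and a Menger argument links the selected sets `A i` and `B i` of pieces `2 * i`
and `2 * i + 1` in both directions (`IsBramble.exists_path_system`).

Following the linkage from `B i` to `A i` and the one from `A i` to `B i` alternately yields closed
walks that visit each vertex at most twice in total. Many closed walks are already a packing. Few of
them, concatenated, form one sequence with few breaks that contains most of the `B i`-`A i` paths as
disjoint intervals: a thread (`exists_thread`).

If two threads have many intersecting pairs of intervals, some crossings occur in increasing order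
on one thread and in decreasing order on the other, and consecutive crossings close up to cycles
(`Thread.card_crossing_le`). Otherwise, averaging selects one interval per thread such that half of
them are pairwise disjoint, and each is closed up by the stretch of the original path from `A i` to
`B i` (`hasCyclePacking_of_threads`). Two threads of multiplicity 2 give congestion 4. For
congestion 2 a thread is first shortened to a genuine path (`Thread.exists_path`), which costs
another factor `k`. -/

namespace Digraph

variable {V : Type u}

open Relation
open scoped Classical

/-! ### Cycles in vertex sets with closed walks -/

/-- The arcs of `G` with both ends in `S`. -/
def AdjOn (G : Digraph V) (S : Set V) (a b : V) : Prop := G.Adj a b ∧ a ∈ S ∧ b ∈ S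

theorem adjOn_mono {G : Digraph V} {S S' : Set V} (h : S ⊆ S') {a b : V} (hab : G.AdjOn S a b) :
    G.AdjOn S' a b := ⟨hab.1, h hab.2.1, h hab.2.2⟩

theorem _root_.Relation.TransGen.exists_seq {α : Type*} {r : α → α → Prop} {a b : α}
    (h : TransGen r a b) :
    ∃ (n : ℕ) (w : ℕ → α), w 0 = a ∧ w (n + 1) = b ∧ ∀ i ≤ n, r (w i) (w (i + 1)) := by
  induction h with
  | @single b h =>
    refine ⟨0, fun i => if i = 0 then a else b, by simp, by simp, fun i hi => ?_⟩
    obtain rfl : i = 0 := by omega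
    simpa using h
  | @tail b c _ hbc ih =>
    obtain ⟨n, w, h0, hn, hw⟩ := ih
    refine ⟨n + 1, fun i => if i ≤ n + 1 then w i else c, by simp [h0], by simp, fun i hi => ?_⟩
    rcases Nat.lt_or_ge i (n + 1) with h | h
    · have h1 : i ≤ n + 1 := by omega
      have h2 : i + 1 ≤ n + 1 := by omega
      simpa [h1, h2, Nat.lt_succ_iff.1 h] using hw i (by omega)
    · obtain rfl : i = n + 1 := by omega
      simpa [hn] using hbc

/-- A shortest closed walk inside `S` repeats no vertex, since a repetition would cut out a shorter
closed walk. The index `n` is the number of arcs minus one. -/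
theorem exists_directedCycle_of_transGen {G : Digraph V} {S : Set V} {v : V}
    (h : TransGen (G.AdjOn S) v v) : ∃ C, G.IsDirectedCycle C ∧ ∀ x ∈ C, x ∈ S := by
  have hex : ∃ n : ℕ, ∃ w : ℕ → V, w 0 = w (n + 1) ∧ ∀ i ≤ n, G.AdjOn S (w i) (w (i + 1)) := by
    obtain ⟨n, w, h0, hn, hw⟩ := h.exists_seq
    exact ⟨n, w, h0.trans hn.symm, hw⟩
  set n := Nat.find hex with hndef
  obtain ⟨w, hw0, hw⟩ := Nat.find_spec hex
  rw [← hndef] at hw0 hw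
  have hinj : ∀ i j, i < j → j ≤ n → w i ≠ w j := by
    intro i j hij hj heq
    have := Nat.find_min hex (m := j - i - 1) (by omega)
    refine this ⟨fun l => w (i + l), ?_, fun l hl => ?_⟩
    · simpa [show i + (j - i - 1 + 1) = j by omega] using heq
    · exact hw (i + l) (by omega)
  refine ⟨((List.range (n + 1)).map w : List V), ⟨?_, ?_, ?_⟩, ?_⟩
  · simp [List.range_succ]
  · rw [Cycle.nodup_coe_iff]
    refine List.Nodup.map_on (fun i hi j hj heq => ?_) List.nodup_range
    rw [List.mem_range] at hi hj
    rcases lt_trichotomy i j with hlt | heq' | hlt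
    · exact (hinj i j hlt (by omega) heq).elim
    · exact heq'
    · exact (hinj j i hlt (by omega) heq.symm).elim
  · have := (Cycle.chain_map (r := G.Adj) w (s := (List.range (n + 1) : List ℕ))).2
    rw [Cycle.map_coe] at this
    refine this ((Cycle.chain_range_succ _ n).2 ⟨?_, fun m hm => (hw m hm.le).1⟩)
    rw [hw0]
    exact (hw n le_rfl).1
  · intro x hx
    rw [Cycle.mem_coe_iff, List.mem_map] at hx
    obtain ⟨i, hi, rfl⟩ := hx
    exact (hw i (Nat.lt_succ_iff.1 (List.mem_range.1 hi))).2.1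

/-- Sufficiently many vertex sets, each containing a closed walk, such that every vertex is in at
most `p` of them, give `k` distinct cycles with the same congestion. -/
theorem hasCyclePacking_of_family {G : Digraph V} {ι : Type*} {p k : ℕ} (hp0 : 0 < p) (s : Finset ι)
    (S : ι → Set V) (hs : p * k ≤ s.card)
    (hS : ∀ i ∈ s, ∃ v, TransGen (G.AdjOn (S i)) v v)
    (hp : ∀ v, ∀ t ⊆ s, (∀ i ∈ t, v ∈ S i) → t.card ≤ p) : G.HasCyclePacking p k := by
  have hC : ∀ i, ∃ C : Cycle V, i ∈ s → G.IsDirectedCycle C ∧ ∀ x ∈ C, x ∈ S i := by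
    intro i
    by_cases hi : i ∈ s
    · obtain ⟨v, hv⟩ := hS i hi
      obtain ⟨C, hC⟩ := exists_directedCycle_of_transGen hv
      exact ⟨C, fun _ => hC⟩
    · exact ⟨Cycle.nil, fun h => (hi h).elim⟩
  choose C hC using hC
  -- Different sets may yield the same cycle, but any vertex of that cycle lies in all of them, so
  -- at most `p` sets share a cycle. This is where the factor `p` in `p * k` is spent.
  have hcard : s.card ≤ p * (s.image C).card := by
    refine Finset.card_le_mul_card_image s p fun c hc => ?_
    obtain ⟨i, hi, rfl⟩ := Finset.mem_image.1 hc
    obtain ⟨x, hx⟩ : ∃ x, x ∈ C i := by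
      rcases hl : C i with ⟨l⟩
      cases l with
      | nil => exact ((hC i hi).1.1 hl).elim
      | cons a l => exact ⟨a, List.mem_cons_self⟩
    refine hp x _ (Finset.filter_subset _ _) fun j hj => ?_
    rw [Finset.mem_filter] at hj
    exact (hC j hj.1).2 x (hj.2 ▸ hx)
  have hk' : k ≤ (s.image C).card := by
    by_contra! hlt
    have := Nat.mul_lt_mul_of_pos_left hlt hp0
    omega
  obtain ⟨F, hF, hFc⟩ := Finset.exists_subset_card_eq hk'
  refine ⟨F, hFc, fun c hc => ?_, fun v => ?_⟩
  · obtain ⟨i, hi, rfl⟩ := Finset.mem_image.1 (hF hc)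
    exact (hC i hi).1
  · refine le_trans ?_ (hp v (s.filter fun i => v ∈ S i) (Finset.filter_subset _ _)
      fun i hi => (Finset.mem_filter.1 hi).2)
    rw [← Set.ncard_coe_finset]
    refine le_trans (Set.ncard_le_ncard (t := C '' (s.filter fun i => v ∈ S i : Finset ι)) ?_
      (Set.toFinite _)) (Set.ncard_image_le (Finset.finite_toSet _))
    rintro c ⟨hc, hvc⟩
    obtain ⟨i, hi, rfl⟩ := Finset.mem_image.1 (hF hc)
    exact ⟨i, by simpa using ⟨hi, (hC i hi).2 v hvc⟩, rfl⟩

/-! ### Disjoint intervals and staircases -/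

/-- Pairwise disjoint intervals of naturals that meet `Q` are at most as many as the elements of
`Q`. -/
theorem card_filter_interval_le {ι : Type*} (s : Finset ι) (lo hi : ι → ℕ)
    (h : ∀ i ∈ s, ∀ j ∈ s, i ≠ j → hi i < lo j ∨ hi j < lo i) (Q : Finset ℕ) :
    (s.filter fun i => ∃ p ∈ Q, lo i ≤ p ∧ p ≤ hi i).card ≤ Q.card := by
  have hp : ∀ i, ∃ p, i ∈ (s.filter fun i => ∃ p ∈ Q, lo i ≤ p ∧ p ≤ hi i) →
      p ∈ Q ∧ lo i ≤ p ∧ p ≤ hi i := by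
    intro i
    by_cases hi' : ∃ p ∈ Q, lo i ≤ p ∧ p ≤ hi i
    · obtain ⟨p, hp⟩ := hi'
      exact ⟨p, fun _ => hp⟩
    · exact ⟨0, fun h => (hi' (Finset.mem_filter.1 h).2).elim⟩
  choose p hp using hp
  refine Finset.card_le_card_of_injOn p (fun i hi => (hp i hi).1) fun i hi' j hj heq => ?_
  by_contra hij
  have h1 := hp i hi'
  have h2 := hp j hj
  rcases h i (Finset.mem_filter.1 hi').1 j (Finset.mem_filter.1 hj).1 hij with h | h <;> omega

/-- A set of points in a grid either contains a long strictly decreasing chain or is small. -/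
theorem exists_decreasing_chain (X Y : Finset ℕ) (m : ℕ) (I : Finset (ℕ × ℕ))
    (hI : I ⊆ X ×ˢ Y) (hm : m * (X.card + Y.card) < I.card) :
    ∃ c : ℕ → ℕ × ℕ, (∀ i ≤ m, c i ∈ I) ∧
      ∀ i < m, (c i).1 < (c (i + 1)).1 ∧ (c (i + 1)).2 < (c i).2 := by
  induction m generalizing I with
  | zero =>
    have : I.Nonempty := Finset.card_pos.1 (by omega)
    obtain ⟨z, hz⟩ := this
    exact ⟨fun _ => z, fun _ _ => hz, fun i hi => by omega⟩
  | succ m ih =>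
    -- `M` consists of the points that cannot be preceded by another one in a decreasing chain. It
    -- is peeled off, a chain is found in the rest, and its first point then has a predecessor in
    -- `I`.
    set M := I.filter fun z => ∀ z' ∈ I, z'.1 < z.1 → ¬ z.2 < z'.2 with hM
    have hMcard : M.card ≤ X.card + Y.card := by
      -- `M` has at most one lowest point per column. Every row holds at most one other point of
      -- `M`: for two of them, the left one would precede a point of `M` below the right one.
      have h1 : (M.filter fun z => ∀ z' ∈ M, z'.1 = z.1 → z.2 ≤ z'.2).card ≤ X.card := by
        refine Finset.card_le_card_of_injOn Prod.fst (fun z hz => ?_) fun z hz z' hz' heq => ?_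
        · have : z ∈ I := (Finset.mem_filter.1 (Finset.mem_filter.1 hz).1).1
          exact (Finset.mem_product.1 (hI this)).1
        · rw [Finset.mem_coe, Finset.mem_filter] at hz hz'
          exact Prod.ext heq (le_antisymm (hz.2 z' hz'.1 heq.symm) (hz'.2 z hz.1 heq))
      have h2 : (M.filter fun z => ¬ ∀ z' ∈ M, z'.1 = z.1 → z.2 ≤ z'.2).card ≤ Y.card := by
        have key : ∀ z ∈ M, ∀ z' ∈ M, (¬ ∀ z'' ∈ M, z''.1 = z'.1 → z'.2 ≤ z''.2) →
            z.2 = z'.2 → ¬ z.1 < z'.1 := by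
          intro z hz z' hz' hn heq hlt
          push Not at hn
          obtain ⟨z'', hz'', h1, h2⟩ := hn
          exact (Finset.mem_filter.1 hz'').2 z (Finset.mem_filter.1 hz).1 (by omega) (by omega)
        refine Finset.card_le_card_of_injOn Prod.snd (fun z hz => ?_) fun z hz z' hz' heq => ?_
        · have : z ∈ I := (Finset.mem_filter.1 (Finset.mem_filter.1 hz).1).1
          exact (Finset.mem_product.1 (hI this)).2
        · rw [Finset.mem_coe, Finset.mem_filter] at hz hz'
          have h1 := key z hz.1 z' hz'.1 hz'.2 heq
          have h2 := key z' hz'.1 z hz.1 hz.2 heq.symm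
          exact Prod.ext (by omega) heq
      have := Finset.card_filter_add_card_filter_not (s := M)
        (fun z => ∀ z' ∈ M, z'.1 = z.1 → z.2 ≤ z'.2)
      omega
    have hcard : m * (X.card + Y.card) < (I \ M).card := by
      have hMI : M ⊆ I := Finset.filter_subset _ _
      have := Finset.card_sdiff_add_card_eq_card hMI
      rw [Nat.succ_mul] at hm
      omega
    obtain ⟨c, hc, hc'⟩ := ih (I \ M) (Finset.sdiff_subset.trans hI) hcard
    have h0 := Finset.mem_sdiff.1 (hc 0 (Nat.zero_le _))
    have : ∃ z ∈ I, z.1 < (c 0).1 ∧ (c 0).2 < z.2 := by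
      by_contra! hcon
      exact h0.2 (Finset.mem_filter.2 ⟨h0.1, fun z hz h => not_lt.2 (hcon z hz h)⟩)
    obtain ⟨z, hz, hz'⟩ := this
    refine ⟨fun i => Nat.casesOn i z c, fun i hi => ?_, fun i hi => ?_⟩
    · cases i with
      | zero => exact hz
      | succ i => exact (Finset.mem_sdiff.1 (hc i (by omega))).1
    · cases i with
      | zero => exact hz'
      | succ i => exact hc' i (by omega)

/-! ### Threads -/

theorem transGen_adjOn_of_seq {G : Digraph V} {S : Set V} (w : ℕ → V) {p p' : ℕ} (hpp : p < p')
    (hstep : ∀ i, p ≤ i → i < p' → G.Adj (w i) (w (i + 1)))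
    (hS : ∀ i, p ≤ i → i ≤ p' → w i ∈ S) : TransGen (G.AdjOn S) (w p) (w p') := by
  obtain ⟨n, rfl⟩ := Nat.exists_eq_add_of_lt hpp
  induction n with
  | zero =>
    exact TransGen.single ⟨hstep p le_rfl (by omega), hS p le_rfl (by omega),
      hS (p + 1) (by omega) (by omega)⟩
  | succ n ih =>
    refine TransGen.tail (ih (by omega) (fun i h1 h2 => hstep i h1 (by omega))
      fun i h1 h2 => hS i h1 (by omega)) ⟨hstep _ (by omega) (by omega),
        hS _ (by omega) (by omega), hS _ (by omega) (by omega)⟩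

theorem reflTransGen_adjOn_of_seq {G : Digraph V} {S : Set V} (w : ℕ → V) {p p' : ℕ}
    (hpp : p ≤ p') (hstep : ∀ i, p ≤ i → i < p' → G.Adj (w i) (w (i + 1)))
    (hS : ∀ i, p ≤ i → i ≤ p' → w i ∈ S) : ReflTransGen (G.AdjOn S) (w p) (w p') := by
  rcases hpp.eq_or_lt with rfl | h
  · exact ReflTransGen.refl
  · exact (transGen_adjOn_of_seq w h hstep hS).to_reflTransGen

/-- A sequence of `N` vertices that is a walk except at the positions in `breaks`, with pairwise
disjoint intervals, given by their first positions in `J` and their last positions `hi`, that are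
walks from `B` to `A`. -/
structure Thread (G : Digraph V) (A B : Set V) where
  /-- The sequence of vertices. -/
  w : ℕ → V
  /-- The length of the sequence. -/
  N : ℕ
  /-- The positions after which the sequence need not follow an arc. -/
  breaks : Finset ℕ
  /-- The first positions of the intervals. -/
  J : Finset ℕ
  /-- The last positions of the intervals. -/
  hi : ℕ → ℕ
  adj : ∀ i, i + 1 < N → i ∉ breaks → G.Adj (w i) (w (i + 1))
  le_hi : ∀ j ∈ J, j ≤ hi j
  hi_lt : ∀ j ∈ J, hi j < N
  free : ∀ j ∈ J, ∀ i, j ≤ i → i < hi j → i ∉ breaks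
  disj : ∀ j ∈ J, ∀ j' ∈ J, j < j' → hi j < j'
  start_mem : ∀ j ∈ J, w j ∈ B
  end_mem : ∀ j ∈ J, w (hi j) ∈ A

namespace Thread

variable {G : Digraph V} {A B A' B' : Set V}

/-- Every vertex is at no more than `q` positions of the thread. -/
def MultLE (T : Thread G A B) (q : ℕ) : Prop :=
  ∀ v, ((Finset.range T.N).filter fun i => T.w i = v).card ≤ q

/-- The vertices of the interval that starts at `j`. -/
def seg (T : Thread G A B) (j : ℕ) : Set V := {v | ∃ i, j ≤ i ∧ i ≤ T.hi j ∧ T.w i = v}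

/-- Fewer intervals in the same thread. -/
def restrict (T : Thread G A B) (J : Finset ℕ) (hJ : J ⊆ T.J) : Thread G A B where
  w := T.w
  N := T.N
  breaks := T.breaks
  J := J
  hi := T.hi
  adj := T.adj
  le_hi j hj := T.le_hi j (hJ hj)
  hi_lt j hj := T.hi_lt j (hJ hj)
  free j hj := T.free j (hJ hj)
  disj j hj j' hj' := T.disj j (hJ hj) j' (hJ hj')
  start_mem j hj := T.start_mem j (hJ hj)
  end_mem j hj := T.end_mem j (hJ hj)

theorem reflTransGen_seg (T : Thread G A B) {j : ℕ} (hj : j ∈ T.J) :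
    ReflTransGen (G.AdjOn (T.seg j)) (T.w j) (T.w (T.hi j)) := by
  have := T.hi_lt j hj
  exact reflTransGen_adjOn_of_seq T.w (T.le_hi j hj)
    (fun i h1 h2 => T.adj i (by omega) (T.free j hj i h1 h2)) fun i h1 h2 => ⟨i, h1, h2, rfl⟩

/-- If the intervals of two threads intersect often, then there are many cycles in the two
threads together. -/
theorem card_crossing_le {p k q q' b b' : ℕ} (hG : ¬ G.HasCyclePacking p k) (hp : 0 < p)
    (hpq : q + q' ≤ p) (T : Thread G A B) (T' : Thread G A' B') (hq : T.MultLE q)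
    (hq' : T'.MultLE q') (hb : T.breaks.card ≤ b) (hb' : T'.breaks.card ≤ b') :
    ((T.J ×ˢ T'.J).filter fun z => ¬ Disjoint (T.seg z.1) (T'.seg z.2)).card ≤
      2 * (p * k + b + b') * (T.J.card + T'.J.card) := by
  by_contra! hlt
  -- The crossings are used in pairs `2 * i`, `2 * i + 1`, and breaks may spoil up to `b + b'` of
  -- the `M` pairs.
  set M := p * k + b + b' with hM
  obtain ⟨c, hcI, hc⟩ := exists_decreasing_chain T.J T'.J _ _ (Finset.filter_subset _ _) hlt
  have hex : ∀ i, ∃ x y : ℕ, i ≤ 2 * M → (c i).1 ≤ x ∧ x ≤ T.hi (c i).1 ∧ (c i).2 ≤ y ∧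
      y ≤ T'.hi (c i).2 ∧ T.w x = T'.w y := by
    intro i
    by_cases hi : i ≤ 2 * M
    · have := (Finset.mem_filter.1 (hcI i hi)).2
      rw [Set.not_disjoint_iff] at this
      obtain ⟨v, ⟨x, h1, h2, h3⟩, ⟨y, h4, h5, h6⟩⟩ := this
      exact ⟨x, y, fun _ => ⟨h1, h2, h4, h5, h3.trans h6.symm⟩⟩
    · exact ⟨0, 0, fun h => (hi h).elim⟩
  choose x y hxy using hex
  have hJ : ∀ i ≤ 2 * M, (c i).1 ∈ T.J ∧ (c i).2 ∈ T'.J := fun i hi =>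
    Finset.mem_product.1 (Finset.mem_filter.1 (hcI i hi)).1
  have hx1 : ∀ i < 2 * M, x i < x (i + 1) := by
    intro i hi
    have h1 := hxy i hi.le
    have h2 := hxy (i + 1) hi
    have h3 := T.disj _ (hJ i hi.le).1 _ (hJ (i + 1) hi).1 (hc i hi).1
    omega
  have hy1 : ∀ i < 2 * M, y (i + 1) < y i := by
    intro i hi
    have h1 := hxy i hi.le
    have h2 := hxy (i + 1) hi
    have h3 := T'.disj _ (hJ (i + 1) hi).2 _ (hJ i hi.le).2 (hc i hi).2
    omega
  have hx : ∀ i j, i < j → j ≤ 2 * M → x i < x j := by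
    intro i j hij
    induction j, hij using Nat.le_induction with
    | base => exact fun h => hx1 i h
    | succ j _ ih => exact fun h => (ih (by omega)).trans (hx1 j h)
  have hy : ∀ i j, i < j → j ≤ 2 * M → y j < y i := by
    intro i j hij
    induction j, hij using Nat.le_induction with
    | base => exact fun h => hy1 i h
    | succ j _ ih => exact fun h => (hy1 j h).trans (ih (by omega))
  have hxN : ∀ i ≤ 2 * M, x i < T.N := fun i hi =>
    (hxy i hi).2.1.trans_lt (T.hi_lt _ (hJ i hi).1)
  have hyN : ∀ i ≤ 2 * M, y i < T'.N := fun i hi =>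
    (hxy i hi).2.2.2.1.trans_lt (T'.hi_lt _ (hJ i hi).2)
  have hdx : ∀ i ∈ Finset.range M, ∀ j ∈ Finset.range M, i ≠ j →
      x (2 * i + 1) < x (2 * j) ∨ x (2 * j + 1) < x (2 * i) := by
    intro i hi j hj hij
    rw [Finset.mem_range] at hi hj
    rcases Nat.lt_or_gt_of_ne hij with h | h
    · exact Or.inl (hx _ _ (by omega) (by omega))
    · exact Or.inr (hx _ _ (by omega) (by omega))
  have hdy : ∀ i ∈ Finset.range M, ∀ j ∈ Finset.range M, i ≠ j →
      y (2 * i) < y (2 * j + 1) ∨ y (2 * j) < y (2 * i + 1) := by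
    intro i hi j hj hij
    rw [Finset.mem_range] at hi hj
    rcases Nat.lt_or_gt_of_ne hij with h | h
    · exact Or.inr (hy _ _ (by omega) (by omega))
    · exact Or.inl (hy _ _ (by omega) (by omega))
  set bx := (Finset.range M).filter fun i =>
    ∃ z ∈ T.breaks, x (2 * i) ≤ z ∧ z ≤ x (2 * i + 1) with hbx
  set bY := (Finset.range M).filter fun i =>
    ∃ z ∈ T'.breaks, y (2 * i + 1) ≤ z ∧ z ≤ y (2 * i) with hbY
  have hbxc : bx.card ≤ b := (card_filter_interval_le _ _ _ hdx _).trans hb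
  have hbYc : bY.card ≤ b' := (card_filter_interval_le _ _ _ hdy _).trans hb'
  set s := Finset.range M \ (bx ∪ bY) with hs
  have hscard : p * k ≤ s.card := by
    have h1 := Finset.le_card_sdiff (bx ∪ bY) (Finset.range M)
    have h2 := Finset.card_union_le bx bY
    rw [Finset.card_range, ← hs] at h1
    omega
  -- Each pair closes up: `T` leads from crossing `2 * i` to crossing `2 * i + 1`, and `T'` leads
  -- back because its order is reversed. Different pairs use disjoint ranges of positions on both
  -- threads, so the multiplicities bound the congestion by `q + q'`.
  refine hG (hasCyclePacking_of_family hp s (fun i => {v | ∃ z ∈ Finset.range T.N,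
    (x (2 * i) ≤ z ∧ z ≤ x (2 * i + 1)) ∧ T.w z = v} ∪ {v | ∃ z ∈ Finset.range T'.N,
    (y (2 * i + 1) ≤ z ∧ z ≤ y (2 * i)) ∧ T'.w z = v}) hscard ?_ ?_)
  · intro i hi
    rw [hs, Finset.mem_sdiff, Finset.mem_union, not_or, Finset.mem_range] at hi
    obtain ⟨hiM, hi1, hi2⟩ := hi
    have hi1' : ∀ z ∈ T.breaks, x (2 * i) ≤ z → ¬ z ≤ x (2 * i + 1) := fun z hz h1 h2 =>
      hi1 (Finset.mem_filter.2 ⟨Finset.mem_range.2 hiM, z, hz, h1, h2⟩)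
    have hi2' : ∀ z ∈ T'.breaks, y (2 * i + 1) ≤ z → ¬ z ≤ y (2 * i) := fun z hz h1 h2 =>
      hi2 (Finset.mem_filter.2 ⟨Finset.mem_range.2 hiM, z, hz, h1, h2⟩)
    have hxlt := hx1 (2 * i) (by omega)
    have hylt := hy1 (2 * i) (by omega)
    have hxN' := hxN (2 * i + 1) (by omega)
    have hyN' := hyN (2 * i) (by omega)
    refine ⟨T.w (x (2 * i)), TransGen.trans (b := T.w (x (2 * i + 1))) ?_ ?_⟩
    · refine transGen_adjOn_of_seq T.w hxlt
        (fun z h1 h2 => T.adj z (by omega) fun hz => hi1' z hz h1 (by omega))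
        fun z h1 h2 => Or.inl ⟨z, Finset.mem_range.2 (by omega), ⟨h1, h2⟩, rfl⟩
    · rw [(hxy (2 * i) (by omega)).2.2.2.2, (hxy (2 * i + 1) (by omega)).2.2.2.2]
      refine transGen_adjOn_of_seq T'.w hylt
        (fun z h1 h2 => T'.adj z (by omega) fun hz => hi2' z hz h1 (by omega))
        fun z h1 h2 => Or.inr ⟨z, Finset.mem_range.2 (by omega), ⟨h1, h2⟩, rfl⟩
  · intro v t hts ht
    refine le_trans ?_ (le_trans (Nat.add_le_add
      ((card_filter_interval_le _ _ _ hdx _).trans (hq v))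
      ((card_filter_interval_le _ _ _ hdy _).trans (hq' v))) hpq)
    refine le_trans (Finset.card_le_card fun i hi => ?_) (Finset.card_union_le _ _)
    have hi1 := (Finset.mem_sdiff.1 (hts hi)).1
    rw [Finset.mem_union, Finset.mem_filter, Finset.mem_filter]
    rcases ht i hi with ⟨z, h1, h2, h3⟩ | ⟨z, h1, h2, h3⟩
    · exact Or.inl ⟨hi1, z, Finset.mem_filter.2 ⟨h1, h3⟩, h2⟩
    · exact Or.inr ⟨hi1, z, Finset.mem_filter.2 ⟨h1, h3⟩, h2⟩

end Thread

/-! ### Transversals with few conflicts -/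

/-- Prescribing two coordinates leaves at most the fraction `1 / s ^ 2` of all transversals. This is
the probability estimate for the averaging argument, cleared of denominators. -/
theorem card_piFinset_filter_pair {r s : ℕ} (J : Fin r → Finset ℕ) (hJ : ∀ i, (J i).card = s)
    {i j : Fin r} (hij : i ≠ j) (x y : ℕ) :
    ((Fintype.piFinset J).filter fun f => f i = x ∧ f j = y).card * s ^ 2 ≤ s ^ r := by
  have h1 : ((Fintype.piFinset J).filter fun f => f i = x ∧ f j = y) ⊆
      Fintype.piFinset fun l => if l = i then {x} else if l = j then {y} else J l := by
    intro f hf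
    rw [Finset.mem_filter, Fintype.mem_piFinset] at hf
    rw [Fintype.mem_piFinset]
    intro l
    by_cases hl : l = i
    · simpa [hl] using hf.2.1
    · by_cases hl' : l = j
      · simpa [hl', hij.symm] using hf.2.2
      · simpa [hl, hl'] using hf.1 l
  have h2 : s ^ 2 = ∏ l : Fin r, if l = i ∨ l = j then s else 1 := by
    rw [Finset.prod_ite, Finset.prod_const, Finset.prod_const_one, mul_one]
    congr 1
    have : (Finset.univ.filter fun l => l = i ∨ l = j) = {i, j} := by ext; simp
    rw [this, Finset.card_pair hij]
  have h3 : s ^ r = ∏ _l : Fin r, s := by simp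
  refine (Nat.mul_le_mul_right _ (Finset.card_le_card h1)).trans ?_
  rw [Fintype.card_piFinset, h2, h3, ← Finset.prod_mul_distrib]
  refine Finset.prod_le_prod' fun l _ => ?_
  by_cases hl : l = i
  · simp [hl]
  · by_cases hl' : l = j
    · simp [hl', hij.symm]
    · simp [hl, hl', hJ]

/-- If the conflicts between any two of `r` classes of size `s` are few, then some choice of one
element from each class has no conflicts among half of the classes. -/
theorem exists_transversal {r s e : ℕ} (J : Fin r → Finset ℕ) (hJ : ∀ i, (J i).card = s)
    (hs : 0 < s) (conf : Fin r → Fin r → ℕ → ℕ → Prop)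
    (he : ∀ i j, i < j → ((J i ×ˢ J j).filter fun z => conf i j z.1 z.2).card ≤ e)
    (hre : 2 * r * e ≤ s ^ 2) :
    ∃ (f : Fin r → ℕ) (R : Finset (Fin r)), (∀ i, f i ∈ J i) ∧ r ≤ 2 * R.card ∧
      ∀ i ∈ R, ∀ j ∈ R, i < j → ¬ conf i j (f i) (f j) := by
  set P := Fintype.piFinset J with hP
  set pairs := (Finset.univ : Finset (Fin r × Fin r)).filter fun z => z.1 < z.2 with hpairs
  have hPc : P.card = s ^ r := by simp [hP, hJ]
  have hpc : pairs.card ≤ r ^ 2 := by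
    refine (Finset.card_filter_le _ _).trans ?_
    simp [sq]
  have hpair : ∀ z ∈ pairs, (P.filter fun f => conf z.1 z.2 (f z.1) (f z.2)).card * s ^ 2 ≤
      e * s ^ r := by
    rintro ⟨i, j⟩ hz
    have hij : i < j := (Finset.mem_filter.1 hz).2
    set C := (J i ×ˢ J j).filter fun z => conf i j z.1 z.2
    have hsub : (P.filter fun f => conf i j (f i) (f j)) ⊆
        C.biUnion fun z => P.filter fun f => f i = z.1 ∧ f j = z.2 := by
      intro f hf
      rw [Finset.mem_filter] at hf
      have hfJ := Fintype.mem_piFinset.1 hf.1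
      refine Finset.mem_biUnion.2 ⟨(f i, f j), ?_, Finset.mem_filter.2 ⟨hf.1, rfl, rfl⟩⟩
      exact Finset.mem_filter.2 ⟨Finset.mem_product.2 ⟨hfJ i, hfJ j⟩, hf.2⟩
    calc _ ≤ (∑ z ∈ C, (P.filter fun f => f i = z.1 ∧ f j = z.2).card) * s ^ 2 :=
          Nat.mul_le_mul_right _ ((Finset.card_le_card hsub).trans Finset.card_biUnion_le)
      _ = ∑ z ∈ C, (P.filter fun f => f i = z.1 ∧ f j = z.2).card * s ^ 2 := Finset.sum_mul _ _ _
      _ ≤ ∑ z ∈ C, s ^ r :=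
          Finset.sum_le_sum fun z _ => card_piFinset_filter_pair J hJ hij.ne z.1 z.2
      _ = C.card * s ^ r := by simp
      _ ≤ e * s ^ r := Nat.mul_le_mul_right _ (he i j hij)
  -- Double counting: on average a transversal has at most `r ^ 2 * e / s ^ 2` conflicts, which is
  -- at most `r / 2` by `hre`.
  have hsum : ∑ f ∈ P, (pairs.filter fun z => conf z.1 z.2 (f z.1) (f z.2)).card * s ^ 2 ≤
      ∑ f ∈ P, r ^ 2 * e := by
    rw [← Finset.sum_mul]
    have := Finset.sum_card_bipartiteAbove_eq_sum_card_bipartiteBelow (s := P) (t := pairs)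
      (fun f z => conf z.1 z.2 (f z.1) (f z.2))
    simp only [Finset.bipartiteAbove, Finset.bipartiteBelow] at this
    rw [this, Finset.sum_mul]
    refine (Finset.sum_le_sum hpair).trans ?_
    rw [Finset.sum_const, Finset.sum_const, smul_eq_mul, smul_eq_mul, hPc]
    calc pairs.card * (e * s ^ r) ≤ r ^ 2 * (e * s ^ r) := Nat.mul_le_mul_right _ hpc
      _ = s ^ r * (r ^ 2 * e) := by ring
  have hPne : P.Nonempty := by
    rw [← Finset.card_pos, hPc]
    positivity
  obtain ⟨f, hf, hfle⟩ := Finset.exists_le_of_sum_le hPne hsum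
  set D := pairs.filter fun z => conf z.1 z.2 (f z.1) (f z.2) with hD
  have hDc : 2 * D.card ≤ r := by
    have h1 : (2 * D.card) * s ^ 2 ≤ r * s ^ 2 := by
      calc (2 * D.card) * s ^ 2 = 2 * (D.card * s ^ 2) := by ring
        _ ≤ 2 * (r ^ 2 * e) := Nat.mul_le_mul_left _ hfle
        _ = r * (2 * r * e) := by ring
        _ ≤ r * s ^ 2 := Nat.mul_le_mul_left _ hre
    exact Nat.le_of_mul_le_mul_right h1 (by positivity)
  -- Dropping the first class of every conflicting pair destroys all conflicts and costs at most `r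
  -- / 2` classes.
  refine ⟨f, Finset.univ \ D.image Prod.fst, Fintype.mem_piFinset.1 hf, ?_, ?_⟩
  · have h1 := Finset.le_card_sdiff (D.image Prod.fst) (Finset.univ : Finset (Fin r))
    have h2 : (D.image Prod.fst).card ≤ D.card := Finset.card_image_le
    rw [Finset.card_univ, Fintype.card_fin] at h1
    omega
  · intro i hi j hj hij hconf
    refine (Finset.mem_sdiff.1 hi).2 (Finset.mem_image.2 ⟨(i, j), ?_, rfl⟩)
    exact Finset.mem_filter.2 ⟨Finset.mem_filter.2 ⟨Finset.mem_univ _, hij⟩, hconf⟩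

/-- Large threads from `B i` to `A i`, together with disjoint ways back from `A i` to `B i`, give
many cycles. -/
theorem hasCyclePacking_of_threads {G : Digraph V} {p k q b r s : ℕ} (hp : 2 ≤ p)
    (hpq : 2 * q ≤ p) (A B U : Fin r → Set V) (T : ∀ i, Thread G (A i) (B i))
    (hq : ∀ i, (T i).MultLE q) (hb : ∀ i, (T i).breaks.card ≤ b)
    (hs : ∀ i, s ≤ (T i).J.card) (hs0 : 0 < s)
    (hU : ∀ i j, i ≠ j → Disjoint (U i) (U j))
    (hAB : ∀ i, ∀ a ∈ A i, ∀ c ∈ B i, TransGen (G.AdjOn (U i)) a c)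
    (hr : 2 * (p * k) ≤ r) (hrs : 8 * r * (p * k + 2 * b) ≤ s) : G.HasCyclePacking p k := by
  by_contra hG
  -- All threads keep exactly `s` intervals, so that the number of crossings is linear in `s` and
  -- `hrs` makes it small against `s ^ 2`.
  have hJ : ∀ i, ∃ J ⊆ (T i).J, J.card = s := fun i => Finset.exists_subset_card_eq (hs i)
  choose J hJsub hJ using hJ
  set T' := fun i => (T i).restrict (J i) (hJsub i) with hT'
  obtain ⟨f, R, hf, hR, hconf⟩ := exists_transversal (r := r) (s := s)
    (e := 2 * (p * k + b + b) * (s + s)) J hJ hs0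
    (fun i j x y => ¬ Disjoint ((T' i).seg x) ((T' j).seg y))
    (fun i j _ => by
      have := Thread.card_crossing_le hG (by omega) (by omega : q + q ≤ p) (T' i) (T' j) (hq i)
        (hq j) (hb i) (hb j)
      have h1 : (T' i).J.card = s := hJ i
      have h2 : (T' j).J.card = s := hJ j
      rw [h1, h2] at this
      convert this <;> simp [T', Thread.restrict])
    (by
      calc 2 * r * (2 * (p * k + b + b) * (s + s)) = (8 * r * (p * k + 2 * b)) * s := by ring
        _ ≤ s * s := Nat.mul_le_mul_right _ hrs
        _ = s ^ 2 := by ring)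
  have hdis : ∀ i ∈ R, ∀ j ∈ R, i ≠ j → Disjoint ((T' i).seg (f i)) ((T' j).seg (f j)) := by
    intro i hi j hj hij
    rcases lt_or_gt_of_ne hij with h | h
    · exact not_not.1 (hconf i hi j hj h)
    · exact (not_not.1 (hconf j hj i hi h)).symm
  -- The selected intervals are pairwise disjoint and so are the `U i`. A vertex therefore lies in
  -- at most one set of each kind, hence in at most two of the unions.
  refine hG (hasCyclePacking_of_family (by omega) R (fun i => (T' i).seg (f i) ∪ U i)
    (by omega) ?_ ?_)
  · intro i _
    refine ⟨(T' i).w (f i), TransGen.trans_right (b := (T' i).w ((T' i).hi (f i))) ?_ ?_⟩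
    · exact ReflTransGen.mono (fun _ _ h => adjOn_mono Set.subset_union_left h) _ _
        ((T' i).reflTransGen_seg (hf i))
    · exact TransGen.mono (fun _ _ h => adjOn_mono Set.subset_union_right h) _ _
        (hAB i _ ((T' i).end_mem _ (hf i)) _ ((T' i).start_mem _ (hf i)))
  · intro v t hts ht
    have hone : ∀ S : Fin r → Set V, (∀ i ∈ R, ∀ j ∈ R, i ≠ j → Disjoint (S i) (S j)) →
        (t.filter fun i => v ∈ S i).card ≤ 1 := by
      intro S hS
      rw [Finset.card_le_one]
      intro i hi j hj
      rw [Finset.mem_filter] at hi hj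
      by_contra hij
      exact Set.disjoint_left.1 (hS i (hts hi.1) j (hts hj.1) hij) hi.2 hj.2
    have h1 := hone _ hdis
    have h2 := hone U fun i _ j _ => hU i j
    refine le_trans (Finset.card_le_card fun i hi => ?_) ((Finset.card_union_le
      (t.filter fun i => v ∈ (T' i).seg (f i)) (t.filter fun i => v ∈ U i)).trans (by omega))
    rw [Finset.mem_union, Finset.mem_filter, Finset.mem_filter]
    exact (ht i hi).imp (fun h => ⟨hi, h⟩) fun h => ⟨hi, h⟩

/-! ### Common independent sets of two matroids -/

/-- The axioms of the rank function of a matroid. -/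
structure IsRankFun {α : Type*} (r : Finset α → ℕ) : Prop where
  empty : r ∅ = 0
  mono : ∀ S T, S ⊆ T → r S ≤ r T
  insert_le : ∀ a S, r (insert a S) ≤ r S + 1
  submod : ∀ S T, r (S ∪ T) + r (S ∩ T) ≤ r S + r T

namespace IsRankFun

variable {α : Type*} {r : Finset α → ℕ}

theorem eq_zero (hr : IsRankFun r) (S : Finset α) (hS : ∀ s ∈ S, r {s} = 0) : r S = 0 := by
  induction S using Finset.induction_on with
  | empty => exact hr.empty
  | insert a S _ ih =>
    have h1 := hr.submod {a} S
    have h2 := ih fun s hs => hS s (Finset.mem_insert_of_mem hs)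
    have h3 := hS a (Finset.mem_insert_self a S)
    rw [← Finset.insert_eq] at h1
    omega

/-- This is contraction of a non-loop. That `s` is not a loop keeps the truncated subtraction exact.
-/
theorem contract (hr : IsRankFun r) {s : α} (hs : r {s} ≠ 0) :
    IsRankFun fun T => r (insert s T) - 1 := by
  have hpos : ∀ T, 1 ≤ r (insert s T) := fun T =>
    (Nat.one_le_iff_ne_zero.2 hs).trans (hr.mono _ _ (by simp))
  refine ⟨?_, fun S T h => ?_, fun a S => ?_, fun S T => ?_⟩
  · have h1 := hr.insert_le s ∅
    have h2 := hr.empty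
    omega
  · exact Nat.sub_le_sub_right (hr.mono _ _ (Finset.insert_subset_insert s h)) 1
  · have h1 := hr.insert_le a (insert s S)
    have h2 := hpos S
    rw [Finset.insert_comm] at h1
    omega
  · have h1 := hr.submod (insert s S) (insert s T)
    rw [← Finset.insert_union_distrib, ← Finset.insert_inter_distrib] at h1
    have h2 := hpos (S ∪ T)
    have h3 := hpos (S ∩ T)
    have h4 := hpos S
    have h5 := hpos T
    omega

/-- The matroid intersection theorem. -/
theorem exists_common_independent {r₁ r₂ : Finset α → ℕ} (h₁ : IsRankFun r₁) (h₂ : IsRankFun r₂)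
    (S : Finset α) (k : ℕ) (h : ∀ T ⊆ S, k ≤ r₁ T + r₂ (S \ T)) :
    ∃ I ⊆ S, I.card = k ∧ r₁ I = k ∧ r₂ I = k := by
  induction hn : S.card generalizing S k r₁ r₂ with
  | zero =>
    rw [Finset.card_eq_zero] at hn
    subst hn
    have h0 := h ∅ le_rfl
    have e1 := h₁.empty
    have e2 := h₂.empty
    simp only [Finset.sdiff_self] at h0
    exact ⟨∅, le_rfl, by simp; omega, by omega, by omega⟩
  | succ n ih =>
    rcases Nat.eq_zero_or_pos k with rfl | hk
    · exact ⟨∅, by simp, by simp, h₁.empty, h₂.empty⟩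
    -- If every element were a loop of one of the matroids, the loops of the first and the remaining
    -- elements would both have rank 0, contradicting `0 < k`.
    obtain ⟨s, hsS, hs1, hs2⟩ : ∃ s ∈ S, r₁ {s} ≠ 0 ∧ r₂ {s} ≠ 0 := by
      by_contra! hcon
      have h0 := h (S.filter fun s => r₁ {s} = 0) (Finset.filter_subset _ _)
      rw [h₁.eq_zero _ fun s hs => (Finset.mem_filter.1 hs).2, h₂.eq_zero _ fun s hs => ?_] at h0
      · omega
      · rw [Finset.mem_sdiff, Finset.mem_filter] at hs
        exact hcon s hs.1 fun h => hs.2 ⟨hs.1, h⟩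
    have hcard : (S.erase s).card = n := by rw [Finset.card_erase_of_mem hsS, hn]; rfl
    by_cases hdel : ∀ T ⊆ S.erase s, k ≤ r₁ T + r₂ (S.erase s \ T)
    · obtain ⟨I, hI, hI'⟩ := ih h₁ h₂ _ _ hdel hcard
      exact ⟨I, hI.trans (Finset.erase_subset _ _), hI'⟩
    push Not at hdel
    obtain ⟨U, hU, hUk⟩ := hdel
    have hsU : s ∉ U := fun hsU => Finset.notMem_erase s S (hU hsU)
    -- Deletion of `s` fails because of `U`, so `s` is contracted. If contraction failed because of
    -- `T`, uncrossing `U` with `insert s T` by submodularity would bound the sums for `U ∩ T` and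
    -- `U ∪ insert s T` by `2 * k - 1` in total, against the hypothesis `h`.
    obtain ⟨I, hI, hIc, hI1, hI2⟩ := ih (h₁.contract hs1) (h₂.contract hs2) (S.erase s) (k - 1)
      (by
        intro T hT
        have hsT : s ∉ T := fun hsT => Finset.notMem_erase s S (hT hsT)
        have hTS := hT.trans (Finset.erase_subset _ _)
        have hUS := hU.trans (Finset.erase_subset _ _)
        have e0 : insert s (S.erase s \ T) = S \ T := by
          ext x
          by_cases hx : x = s
          · simp [hx, hsS, hsT]
          · simp [hx]
        rw [e0]
        have a1 := h₁.submod U (insert s T)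
        have a2 := h₂.submod (S.erase s \ U) (S \ T)
        have e1 : U ∩ insert s T = U ∩ T := by
          ext x
          by_cases hx : x = s
          · simp [hx, hsU]
          · simp [hx]
        have e2 : (S.erase s \ U) ∪ (S \ T) = S \ (U ∩ T) := by
          ext x
          by_cases hx : x = s
          · simp [hx, hsS, hsT, hsU]
          · simp [hx]; tauto
        have e3 : (S.erase s \ U) ∩ (S \ T) = S \ (U ∪ insert s T) := by
          ext x
          by_cases hx : x = s
          · simp [hx]
          · simp [hx]; tauto
        rw [e1] at a1
        rw [e2, e3] at a2
        have b1 := h (U ∩ T) (Finset.inter_subset_left.trans hUS)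
        have b2 := h (U ∪ insert s T)
          (Finset.union_subset hUS (Finset.insert_subset hsS hTS))
        have c1 : 1 ≤ r₁ (insert s T) :=
          (Nat.one_le_iff_ne_zero.2 hs1).trans (h₁.mono _ _ (by simp))
        have c2 : 1 ≤ r₂ (S \ T) :=
          (Nat.one_le_iff_ne_zero.2 hs2).trans (h₂.mono _ _ (by simp [hsS, hsT]))
        omega) hcard
    have hsI : s ∉ I := fun hsI => Finset.notMem_erase s S (hI hsI)
    have c1 : 1 ≤ r₁ (insert s I) :=
      (Nat.one_le_iff_ne_zero.2 hs1).trans (h₁.mono _ _ (by simp))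
    have c2 : 1 ≤ r₂ (insert s I) :=
      (Nat.one_le_iff_ne_zero.2 hs2).trans (h₂.mono _ _ (by simp))
    refine ⟨insert s I, Finset.insert_subset hsS (hI.trans (Finset.erase_subset _ _)), ?_, ?_, ?_⟩
    · rw [Finset.card_insert_of_notMem hsI, hIc]
      omega
    · omega
    · omega

end IsRankFun

/-! ### Brambles and linkages -/

/-- The digraph with all arcs reversed. -/
def rev (G : Digraph V) : Digraph V where
  Adj a b := G.Adj b a

/-- A family of pairwise intersecting vertex sets that induce strongly connected subdigraphs and
cannot be hit by fewer than `n` vertices. -/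
structure IsBramble (G : Digraph V) (𝓑 : Set (Set V)) (n : ℕ) : Prop where
  conn : ∀ U ∈ 𝓑, ∀ a ∈ U, ∀ b ∈ U, ReflTransGen (G.AdjOn U) a b
  inter : ∀ U ∈ 𝓑, ∀ U' ∈ 𝓑, (U ∩ U').Nonempty
  order : ∀ X : Finset V, X.card < n → ∃ U ∈ 𝓑, ∀ x ∈ X, x ∉ U

theorem IsBramble.rev {G : Digraph V} {𝓑 : Set (Set V)} {n : ℕ} (h : G.IsBramble 𝓑 n) :
    G.rev.IsBramble 𝓑 n := by
  refine ⟨fun U hU a ha b hb => ?_, h.inter, h.order⟩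
  have := h.conn U hU b hb a ha
  rw [← reflTransGen_swap] at this
  exact ReflTransGen.mono (fun x y hxy => ⟨hxy.1, hxy.2.2, hxy.2.1⟩) _ _ this

/-- `Y` is separated from the bramble by `m` vertices. -/
def IsSeparated (G : Digraph V) (𝓑 : Set (Set V)) (Y : Finset V) (m : ℕ) : Prop :=
  ∃ C I : Finset V, Y ⊆ C ∧ I ⊆ C ∧ (∀ x ∈ I, ∀ y, G.Adj x y → y ∈ C) ∧
    (∀ U ∈ 𝓑, ¬ U ⊆ I) ∧ C.card = I.card + m

/-- The least number of vertices that separate `Y` from the bramble, but at most `d`. -/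
noncomputable def bramRank (G : Digraph V) (𝓑 : Set (Set V)) (d : ℕ) (Y : Finset V) : ℕ :=
  sInf {m | m = d ∨ G.IsSeparated 𝓑 Y m}

section Rank

variable {G : Digraph V} {𝓑 : Set (Set V)} {d n : ℕ}

theorem bramRank_le (Y : Finset V) : G.bramRank 𝓑 d Y ≤ d := Nat.sInf_le (Or.inl rfl)

theorem bramRank_le_of_isSeparated {Y : Finset V} {m : ℕ} (h : G.IsSeparated 𝓑 Y m) :
    G.bramRank 𝓑 d Y ≤ m := Nat.sInf_le (Or.inr h)

theorem bramRank_cases (Y : Finset V) :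
    G.bramRank 𝓑 d Y = d ∨ G.IsSeparated 𝓑 Y (G.bramRank 𝓑 d Y) :=
  Nat.sInf_mem (s := {m | m = d ∨ G.IsSeparated 𝓑 Y m}) ⟨d, Or.inl rfl⟩

theorem bramRank_mono {S T : Finset V} (h : S ⊆ T) : G.bramRank 𝓑 d S ≤ G.bramRank 𝓑 d T := by
  rcases G.bramRank_cases (𝓑 := 𝓑) (d := d) T with hT | ⟨C, I, h1, h2⟩
  · rw [hT]
    exact bramRank_le S
  · exact bramRank_le_of_isSeparated ⟨C, I, h.trans h1, h2⟩

/-- A connected set that avoids the boundary `C \ I` and meets `I` is contained in `I`. -/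
theorem IsBramble.subset_of_meets (hB : G.IsBramble 𝓑 n) {C I : Finset V}
    (hCI : ∀ x ∈ I, ∀ y, G.Adj x y → y ∈ C) {U : Set V} (hU : U ∈ 𝓑)
    (hd : ∀ x ∈ C \ I, x ∉ U) {a : V} (ha : a ∈ U) (haI : a ∈ I) : U ⊆ I := by
  intro b hb
  have := hB.conn U hU a ha b hb
  induction this with
  | refl => exact haI
  | @tail x y _ hxy ih =>
    by_contra hy
    exact hd y (Finset.mem_sdiff.2 ⟨hCI x (ih hxy.2.1) y hxy.1, hy⟩) hxy.2.2

/-- For submodularity, two separating pairs `(C, I)` are replaced by their union and their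
intersection, which preserves the sum of `C.card - I.card`. The union must not swallow a bramble
set. Both boundaries together have fewer than `2 * d` vertices, so some bramble set avoids them; it
meets any bramble set inside `I ∪ I'`, and by connectivity it would lie in `I` or in `I'`. -/
theorem IsBramble.isRankFun (hB : G.IsBramble 𝓑 n) (hd : 2 * d ≤ n) :
    IsRankFun (G.bramRank 𝓑 d) := by
  refine ⟨?_, fun S T h => bramRank_mono h, fun a S => ?_, fun S T => ?_⟩
  · refine Nat.le_zero.1 (bramRank_le_of_isSeparated ⟨∅, ∅, by simp, by simp, by simp, ?_, by simp⟩)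
    intro U hU hsub
    obtain ⟨x, hx, _⟩ := hB.inter U hU U hU
    simpa using hsub hx
  · rcases G.bramRank_cases (𝓑 := 𝓑) (d := d) S with hS | ⟨C, I, h1, h2, h3, h4, h5⟩
    · have := G.bramRank_le (𝓑 := 𝓑) (d := d) (insert a S)
      omega
    · by_cases ha : a ∈ C
      · have : G.bramRank 𝓑 d (insert a S) ≤ _ :=
          bramRank_le_of_isSeparated ⟨C, I, Finset.insert_subset ha h1, h2, h3, h4, h5⟩
        omega
      · refine bramRank_le_of_isSeparated ⟨insert a C, I, Finset.insert_subset_insert a h1,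
          h2.trans (Finset.subset_insert _ _), fun x hx y hxy =>
            Finset.mem_insert_of_mem (h3 x hx y hxy), h4, ?_⟩
        rw [Finset.card_insert_of_notMem ha]
        omega
  · have m1 : G.bramRank 𝓑 d (S ∩ T) ≤ G.bramRank 𝓑 d S := bramRank_mono Finset.inter_subset_left
    have m2 : G.bramRank 𝓑 d (S ∩ T) ≤ G.bramRank 𝓑 d T := bramRank_mono Finset.inter_subset_right
    have m3 := G.bramRank_le (𝓑 := 𝓑) (d := d) (S ∪ T)
    -- When a rank attains the cap `d`, the inequality follows from monotonicity.
    by_cases hSd : G.bramRank 𝓑 d S = d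
    · omega
    by_cases hTd : G.bramRank 𝓑 d T = d
    · omega
    have hSle := G.bramRank_le (𝓑 := 𝓑) (d := d) S
    have hTle := G.bramRank_le (𝓑 := 𝓑) (d := d) T
    obtain ⟨C, I, h1, h2, h3, h4, h5⟩ := (G.bramRank_cases (𝓑 := 𝓑) (d := d) S).resolve_left hSd
    obtain ⟨C', I', h1', h2', h3', h4', h5'⟩ :=
      (G.bramRank_cases (𝓑 := 𝓑) (d := d) T).resolve_left hTd
    have hC := Finset.card_union_add_card_inter C C'
    have hI := Finset.card_union_add_card_inter I I'
    have hIC : I ∪ I' ⊆ C ∪ C' := Finset.union_subset_union h2 h2'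
    have hIC' : I ∩ I' ⊆ C ∩ C' := Finset.inter_subset_inter h2 h2'
    have l1 := Finset.card_le_card hIC
    have l2 := Finset.card_le_card hIC'
    have s1 : G.bramRank 𝓑 d (S ∪ T) ≤ (C ∪ C').card - (I ∪ I').card := by
      refine bramRank_le_of_isSeparated ⟨C ∪ C', I ∪ I', Finset.union_subset_union h1 h1', hIC,
        fun x hx y hxy => ?_, fun U hU hUI => ?_, by omega⟩
      · rcases Finset.mem_union.1 hx with hx | hx
        · exact Finset.mem_union_left _ (h3 x hx y hxy)
        · exact Finset.mem_union_right _ (h3' x hx y hxy)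
      · have c1 := Finset.card_union_le (C \ I) (C' \ I')
        have c2 := Finset.card_sdiff_add_card_eq_card h2
        have c3 := Finset.card_sdiff_add_card_eq_card h2'
        obtain ⟨U', hU', hU'd⟩ := hB.order ((C \ I) ∪ (C' \ I')) (by omega)
        obtain ⟨x, hxU, hxU'⟩ := hB.inter U hU U' hU'
        rcases Finset.mem_union.1 (Finset.mem_coe.1 (hUI hxU)) with hx | hx
        · exact h4 U' hU' (hB.subset_of_meets h3 hU'
            (fun y hy => hU'd y (Finset.mem_union_left _ hy)) hxU' hx)
        · exact h4' U' hU' (hB.subset_of_meets h3' hU'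
            (fun y hy => hU'd y (Finset.mem_union_right _ hy)) hxU' hx)
    have s2 : G.bramRank 𝓑 d (S ∩ T) ≤ (C ∩ C').card - (I ∩ I').card := by
      refine bramRank_le_of_isSeparated ⟨C ∩ C', I ∩ I', Finset.inter_subset_inter h1 h1', hIC',
        fun x hx y hxy => ?_, fun U hU hUI => ?_, by omega⟩
      · rw [Finset.mem_inter] at hx ⊢
        exact ⟨h3 x hx.1 y hxy, h3' x hx.2 y hxy⟩
      · exact h4 U hU (hUI.trans (by simp))
    omega

/-- Disjoint paths from `A` to `B` that cover all of `A` and `B`, given by the successor function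
on the vertices outside `B`; the fixed points are the vertices that are on no path. -/
structure IsLinkage (G : Digraph V) (A B : Finset V) (f : V → V) : Prop where
  inj : ∀ x, x ∉ B → ∀ y, y ∉ B → f x = f y → x = y
  notMem : ∀ x, x ∉ B → f x ∉ A
  adj : ∀ x, x ∉ B → f x = x ∨ G.Adj x (f x)

/-- Menger's theorem by way of Hall's: every vertex outside `B` is matched to itself or to an
out-neighbour, always outside `A`. A Hall violator `Y`, with `C` its neighbourhood together with
`A`, satisfies `C.card - Y.card < d`. Then `(C, Y)` separates `A` from the bramble, unless a bramble
set lies in `Y`; in that case no bramble set lies in `Cᶜ`, and `(Yᶜ, Cᶜ)` separates `B` in the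
reversed digraph. -/
theorem IsBramble.exists_isLinkage [Fintype V] (hB : G.IsBramble 𝓑 n) {A B : Finset V}
    (hA : A.card = d) (hBd : B.card = d) (hrA : G.bramRank 𝓑 d A = d)
    (hrB : G.rev.bramRank 𝓑 d B = d) : ∃ f, G.IsLinkage A B f := by
  set t : {v : V // v ∉ B} → Finset V := fun v =>
    Finset.univ.filter fun w => w ∉ A ∧ (w = v ∨ G.Adj v w) with ht
  have hall : ∀ s : Finset {v : V // v ∉ B}, s.card ≤ (s.biUnion t).card := by
    intro s
    by_contra! hlt
    set Y : Finset V := s.map (Function.Embedding.subtype _) with hY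
    have hYc : Y.card = s.card := Finset.card_map _
    have hYB : ∀ y ∈ Y, y ∉ B := by
      intro y hy
      obtain ⟨z, _, rfl⟩ := Finset.mem_map.1 hy
      exact z.2
    set C := s.biUnion t ∪ A with hC
    have hdisj : Disjoint (s.biUnion t) A := by
      rw [Finset.disjoint_left]
      intro w hw
      obtain ⟨v, _, hv⟩ := Finset.mem_biUnion.1 hw
      exact (Finset.mem_filter.1 hv).2.1
    have hCc : C.card = (s.biUnion t).card + d := by rw [hC, Finset.card_union_of_disjoint hdisj, hA]
    have hin : ∀ y ∈ Y, ∀ w, (w = y ∨ G.Adj y w) → w ∈ C := by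
      intro y hy w hw
      obtain ⟨z, hz, rfl⟩ := Finset.mem_map.1 hy
      by_cases hwA : w ∈ A
      · exact Finset.mem_union_right _ hwA
      · exact Finset.mem_union_left _ (Finset.mem_biUnion.2 ⟨z, hz, by simp [ht, hwA]; exact hw⟩)
    have hYC : Y ⊆ C := fun y hy => hin y hy y (Or.inl rfl)
    have hle := Finset.card_le_card hYC
    by_cases hsmall : ∀ U ∈ 𝓑, ¬ U ⊆ Y
    · have := bramRank_le_of_isSeparated (G := G) (𝓑 := 𝓑) (d := d) (Y := A)
        (m := C.card - Y.card) ⟨C, Y, Finset.subset_union_right, hYC,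
          fun x hx y hxy => hin x hx y (Or.inr hxy), hsmall, by omega⟩
      omega
    · push Not at hsmall
      obtain ⟨U, hU, hUY⟩ := hsmall
      have h1 := Finset.card_compl C
      have h2 := Finset.card_compl Y
      have h3 := Finset.card_le_univ C
      have := bramRank_le_of_isSeparated (G := G.rev) (𝓑 := 𝓑) (d := d) (Y := B)
        (m := C.card - Y.card) ⟨Yᶜ, Cᶜ, fun x hx => Finset.mem_compl.2 fun h => hYB x h hx,
          Finset.compl_subset_compl.2 hYC, ?_, ?_, by omega⟩
      · omega
      · intro x hx y hxy
        rw [Finset.mem_compl] at hx ⊢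
        exact fun hy => hx (hin y hy x (Or.inr hxy))
      · intro U' hU' hU'C
        obtain ⟨x, hx, hx'⟩ := hB.inter U hU U' hU'
        have := hU'C hx'
        rw [Finset.mem_coe, Finset.mem_compl] at this
        exact this (hYC (hUY hx))
  obtain ⟨f, hf, hft⟩ := (Finset.all_card_le_biUnion_card_iff_exists_injective t).1 hall
  have hf' : ∀ x (hx : x ∉ B), f ⟨x, hx⟩ ∉ A ∧ (f ⟨x, hx⟩ = x ∨ G.Adj x (f ⟨x, hx⟩)) :=
    fun x hx => (Finset.mem_filter.1 (hft ⟨x, hx⟩)).2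
  refine ⟨fun v => if hv : v ∉ B then f ⟨v, hv⟩ else v, fun x hx y hy h => ?_, fun x hx => ?_,
    fun x hx => ?_⟩
  · simp only [hx, hy, not_false_eq_true, dif_pos] at h
    exact Subtype.ext_iff.1 (hf h)
  · simp only [hx, not_false_eq_true, dif_pos]
    exact (hf' x hx).1
  · simp only [hx, not_false_eq_true, dif_pos]
    exact (hf' x hx).2

/-- If fewer than `d` vertices never hit all sets of the bramble that meet `S`, then `S` contains
`d` vertices that are linked to and from the bramble. -/
theorem IsBramble.exists_linked_subset (hB : G.IsBramble 𝓑 n) (hd : 2 * d ≤ n) (S : Finset V)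
    (hS : ∀ X : Finset V, X.card < d → ∃ U ∈ 𝓑, (∀ x ∈ X, x ∉ U) ∧ ∃ x ∈ S, x ∈ U) :
    ∃ A ⊆ S, A.card = d ∧ G.bramRank 𝓑 d A = d ∧ G.rev.bramRank 𝓑 d A = d := by
  refine (hB.isRankFun hd).exists_common_independent (hB.rev.isRankFun hd) S d fun T hT => ?_
  rcases G.bramRank_cases (𝓑 := 𝓑) (d := d) T with h | ⟨C, I, h1, h2, h3, h4, h5⟩
  · omega
  rcases G.rev.bramRank_cases (𝓑 := 𝓑) (d := d) (S \ T) with h | ⟨C', I', h1', h2', h3', h4', h5'⟩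
  · omega
  by_contra! hlt
  have c1 := Finset.card_union_le (C \ I) (C' \ I')
  have c2 := Finset.card_sdiff_add_card_eq_card h2
  have c3 := Finset.card_sdiff_add_card_eq_card h2'
  -- The two boundaries together have fewer than `d` vertices, so a bramble set that meets `S`
  -- avoids both. Being connected, it is trapped in `I` or in `I'`.
  obtain ⟨U, hU, hUX, x, hxS, hxU⟩ := hS ((C \ I) ∪ (C' \ I')) (by omega)
  have hU1 : ∀ y ∈ C \ I, y ∉ U := fun y hy => hUX y (Finset.mem_union_left _ hy)
  have hU2 : ∀ y ∈ C' \ I', y ∉ U := fun y hy => hUX y (Finset.mem_union_right _ hy)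
  by_cases hxT : x ∈ T
  · have hxI : x ∈ I := by
      by_contra hx
      exact hU1 x (Finset.mem_sdiff.2 ⟨h1 hxT, hx⟩) hxU
    exact h4 U hU (hB.subset_of_meets h3 hU hU1 hxU hxI)
  · have hxI : x ∈ I' := by
      by_contra hx
      exact hU2 x (Finset.mem_sdiff.2 ⟨h1' (Finset.mem_sdiff.2 ⟨hxS, hxT⟩), hx⟩) hxU
    exact h4' U hU (hB.rev.subset_of_meets h3' hU hU2 hxU hxI)

end Rank

/-! ### Threads from linkages -/

theorem iterate_mem {α : Type*} {s : α → α} {S : Finset α} (hmap : ∀ x ∈ S, s x ∈ S) {x : α}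
    (hx : x ∈ S) (i : ℕ) : s^[i] x ∈ S := by
  induction i with
  | zero => exact hx
  | succ i ih =>
    rw [Function.iterate_succ_apply']
    exact hmap _ ih

theorem minimalPeriod_pos_of_injOn {α : Type*} {s : α → α} {S : Finset α}
    (hmap : ∀ x ∈ S, s x ∈ S) (hinj : ∀ x ∈ S, ∀ y ∈ S, s x = s y → x = y) {x : α}
    (hx : x ∈ S) : 0 < Function.minimalPeriod s x := by
  obtain ⟨i, j, hij, heq⟩ : ∃ i j : ℕ, i < j ∧ s^[i] x = s^[j] x := by
    by_contra! hcon
    have hinj' : Function.Injective fun i : ℕ => (⟨s^[i] x, iterate_mem hmap hx i⟩ : S) := by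
      intro i j h
      have h' : s^[i] x = s^[j] x := Subtype.ext_iff.1 h
      rcases lt_trichotomy i j with hlt | h0 | hlt
      · exact (hcon i j hlt h').elim
      · exact h0
      · exact (hcon j i hlt h'.symm).elim
    exact not_injective_infinite_finite _ hinj'
  have hcancel : ∀ i, ∀ y ∈ S, ∀ z ∈ S, s^[i] y = s^[i] z → y = z := by
    intro i
    induction i with
    | zero => exact fun y _ z _ h => h
    | succ i ih =>
      intro y hy z hz h
      rw [Function.iterate_succ_apply', Function.iterate_succ_apply'] at h
      exact ih y hy z hz (hinj _ (iterate_mem hmap hy i) _ (iterate_mem hmap hz i) h)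
  refine Function.IsPeriodicPt.minimalPeriod_pos (n := j - i) (by omega) ?_
  refine (hcancel i x hx _ (iterate_mem hmap hx _) ?_).symm
  rw [← Function.iterate_add_apply, heq]
  congr 2
  omega

/-- A finite set with an injective self-map can be listed orbit by orbit. -/
theorem exists_orbit_enumeration {α : Type*} [Nonempty α] (s : α → α) (S : Finset α)
    (hmap : ∀ x ∈ S, s x ∈ S) (hinj : ∀ x ∈ S, ∀ y ∈ S, s x = s y → x = y) :
    ∃ (e : ℕ → α) (β : Finset ℕ) (reps : Finset α),
      (∀ i < S.card, e i ∈ S) ∧ (∀ i < S.card, ∀ j < S.card, e i = e j → i = j) ∧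
      (∀ x ∈ S, ∃ i < S.card, e i = x) ∧
      (∀ i < S.card, i ∉ β → i + 1 < S.card ∧ e (i + 1) = s (e i)) ∧
      reps.card = β.card ∧ reps ⊆ S ∧
      ∀ x ∈ reps, ∀ y ∈ reps, x ≠ y → ∀ i j, s^[i] x ≠ s^[j] y := by
  induction hn : S.card using Nat.strong_induction_on generalizing S with
  | _ n ih =>
  rcases S.eq_empty_or_nonempty with rfl | ⟨x, hx⟩
  · rw [Finset.card_empty] at hn
    subst hn
    exact ⟨fun _ => Classical.arbitrary α, ∅, ∅, by simp⟩
  set m := Function.minimalPeriod s x with hm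
  have hmpos : 0 < m := minimalPeriod_pos_of_injOn hmap hinj hx
  set O := (Finset.range m).image fun i => s^[i] x with hO
  have hOmem : ∀ i, s^[i] x ∈ O := fun i => Finset.mem_image.2
    ⟨i % m, Finset.mem_range.2 (Nat.mod_lt _ hmpos), Function.iterate_mod_minimalPeriod_eq⟩
  have hOS : O ⊆ S := by
    intro y hy
    obtain ⟨i, _, rfl⟩ := Finset.mem_image.1 hy
    exact iterate_mem hmap hx i
  have hinjm : ∀ i < m, ∀ j < m, s^[i] x = s^[j] x → i = j := fun i hi j hj h =>
    Function.iterate_injOn_Iio_minimalPeriod hi hj h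
  have hOc : O.card = m := by
    rw [hO, Finset.card_image_of_injOn, Finset.card_range]
    intro i hi j hj h
    exact hinjm i (by simpa using hi) j (by simpa using hj) h
  have hcard := Finset.card_sdiff_add_card_eq_card hOS
  have hmapS : ∀ y ∈ S \ O, s y ∈ S \ O := by
    intro y hy
    rw [Finset.mem_sdiff] at hy ⊢
    refine ⟨hmap y hy.1, fun hsy => hy.2 ?_⟩
    obtain ⟨i, _, hi⟩ := Finset.mem_image.1 hsy
    have h1 : s^[i] x = s (s^[i + m - 1] x) := by
      rw [← Function.iterate_succ_apply' s, show (i + m - 1).succ = i + m by omega,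
        Function.iterate_add_apply, hm, Function.iterate_minimalPeriod]
    have h2 := hinj _ hy.1 _ (iterate_mem hmap hx (i + m - 1)) (hi.symm.trans h1)
    rw [h2]
    exact hOmem _
  obtain ⟨e, β, reps, h1, h2, h3, h4, h5, h6, h7⟩ := ih (S \ O).card (by omega) (S \ O) hmapS
    (fun y hy z hz => hinj y (Finset.mem_sdiff.1 hy).1 z (Finset.mem_sdiff.1 hz).1) rfl
  have hsdiff : ∀ i, i < (S \ O).card → e i ∉ O := fun i hi => (Finset.mem_sdiff.1 (h1 i hi)).2
  have hxr : x ∉ reps := fun hxr => (Finset.mem_sdiff.1 (h6 hxr)).2 (hOmem 0)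
  -- The orbit of `x` is listed before the others, whose positions shift by `m`. The set `β`
  -- collects the last position of each orbit.
  refine ⟨fun i => if i < m then s^[i] x else e (i - m),
    insert (m - 1) (β.image fun i => i + m), insert x reps, fun i hi => ?_, fun i hi j hj h => ?_,
    fun y hy => ?_, fun i hi hiβ => ?_, ?_, ?_, ?_⟩
  · by_cases him : i < m
    · simpa [him] using iterate_mem hmap hx i
    · simpa [him] using (Finset.mem_sdiff.1 (h1 (i - m) (by omega))).1
  · by_cases him : i < m <;> by_cases hjm : j < m <;> simp only [him, hjm, if_true, if_false] at h
    · exact hinjm i him j hjm h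
    · exact (hsdiff (j - m) (by omega) (h ▸ hOmem i)).elim
    · exact (hsdiff (i - m) (by omega) (h ▸ hOmem j)).elim
    · have := h2 (i - m) (by omega) (j - m) (by omega) h
      omega
  · by_cases hyO : y ∈ O
    · obtain ⟨i, hi, rfl⟩ := Finset.mem_image.1 hyO
      rw [Finset.mem_range] at hi
      exact ⟨i, by omega, by simp [hi]⟩
    · obtain ⟨i, hi, rfl⟩ := h3 y (Finset.mem_sdiff.2 ⟨hy, hyO⟩)
      exact ⟨i + m, by omega, by simp⟩
  · rw [Finset.mem_insert, not_or] at hiβ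
    by_cases him : i < m
    · have him' : i + 1 < m := by omega
      refine ⟨by omega, ?_⟩
      simp only [him, him', if_true]
      exact Function.iterate_succ_apply' s i x
    · have him' : ¬ i + 1 < m := by omega
      obtain ⟨h8, h9⟩ := h4 (i - m) (by omega) fun hmem =>
        hiβ.2 (Finset.mem_image.2 ⟨i - m, hmem, by omega⟩)
      refine ⟨by omega, ?_⟩
      simp only [him, him', if_false]
      rw [← h9]
      congr 1
      omega
  · rw [Finset.card_insert_of_notMem hxr, Finset.card_insert_of_notMem, h5,
      Finset.card_image_of_injective _ (add_left_injective m)]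
    intro hmem
    obtain ⟨i, _, hi⟩ := Finset.mem_image.1 hmem
    omega
  · exact Finset.insert_subset hx (h6.trans Finset.sdiff_subset)
  · have key : ∀ y ∈ reps, ∀ i j, s^[i] x ≠ s^[j] y := by
      intro y hy i j h
      have := iterate_mem hmapS (h6 hy) j
      rw [← h] at this
      exact (Finset.mem_sdiff.1 this).2 (hOmem i)
    intro y hy z hz hyz i j
    rw [Finset.mem_insert] at hy hz
    rcases hy with rfl | hy <;> rcases hz with rfl | hz
    · exact (hyz rfl).elim
    · exact key z hz i j
    · exact (key y hy j i).symm
    · exact h7 y hy z hz hyz i j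

section Tokens

variable {G : Digraph V} {A B : Finset V} {f g : V → V}

/-- The successor map that follows the linkage `f` from `B` to `A` on the tokens `(true, v)` and
the linkage `g` from `A` to `B` on the tokens `(false, v)`. -/
noncomputable def tokenSucc (A B : Finset V) (f g : V → V) (x : Bool × V) : Bool × V :=
  if x.1 = true then (decide (f x.2 ∉ A), f x.2) else (decide (g x.2 ∈ B), g x.2)

theorem tokenSucc_true (v : V) : tokenSucc A B f g (true, v) = (decide (f v ∉ A), f v) := rfl

theorem tokenSucc_false (v : V) : tokenSucc A B f g (false, v) = (decide (g v ∈ B), g v) := rfl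

/-- The tokens on which `tokenSucc` is a fixed-point free permutation. -/
noncomputable def tokens [Fintype V] (A B : Finset V) (f g : V → V) : Finset (Bool × V) :=
  Finset.univ.filter fun x => (x.1 = true → x.2 ∉ A) ∧ (x.1 = false → x.2 ∉ B) ∧
    tokenSucc A B f g x ≠ x

theorem card_tokens_label_le (v : V) (t : Finset (Bool × V)) (ht : ∀ x ∈ t, x.2 = v) :
    t.card ≤ 2 := by
  have : t ⊆ {(true, v), (false, v)} := by
    rintro ⟨b, x⟩ hx
    obtain rfl : x = v := ht _ hx
    cases b <;> simp
  exact (Finset.card_le_card this).trans Finset.card_le_two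

/-- Tokens with equal flags are separated by the linkages. For different flags, a common image would
have its vertex outside both `A` and `B`, and there the flag does not change. -/
theorem tokenSucc_inj (hf : G.IsLinkage B A f) (hg : G.IsLinkage A B g) (x y : Bool × V)
    (hx : x.1 = true → x.2 ∉ A) (hx' : x.1 = false → x.2 ∉ B)
    (hy : y.1 = true → y.2 ∉ A) (hy' : y.1 = false → y.2 ∉ B)
    (h : tokenSucc A B f g x = tokenSucc A B f g y) : x = y := by
  rcases x with ⟨bx, x⟩
  rcases y with ⟨bY, y⟩
  cases bx <;> cases bY <;> simp only [tokenSucc_true, tokenSucc_false, Prod.mk.injEq,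
    decide_eq_decide] at h hx hx' hy hy' ⊢
  · exact ⟨trivial, hg.inj x (hx' trivial) y (hy' trivial) h.2⟩
  · have h1 := hg.notMem x (hx' trivial)
    have h2 := hf.notMem y (hy trivial)
    rw [← h.2] at h2
    rw [← h.2] at h
    exact (h2 (h.1.2 h1)).elim
  · have h1 := hg.notMem y (hy' trivial)
    have h2 := hf.notMem x (hx trivial)
    rw [h.2] at h2
    rw [h.2] at h
    exact (h2 (h.1.1 h1)).elim
  · exact ⟨trivial, hf.inj x (hx trivial) y (hy trivial) h.2⟩

variable [Fintype V]

theorem mem_tokens {x : Bool × V} : x ∈ tokens A B f g ↔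
    (x.1 = true → x.2 ∉ A) ∧ (x.1 = false → x.2 ∉ B) ∧ tokenSucc A B f g x ≠ x := by
  simp [tokens]

theorem tokenSucc_mem (hf : G.IsLinkage B A f) (hg : G.IsLinkage A B g) (hAB : Disjoint A B)
    (x : Bool × V) (hx : x ∈ tokens A B f g) : tokenSucc A B f g x ∈ tokens A B f g := by
  rw [mem_tokens] at hx ⊢
  have hv : ((tokenSucc A B f g x).1 = true → (tokenSucc A B f g x).2 ∉ A) ∧
      ((tokenSucc A B f g x).1 = false → (tokenSucc A B f g x).2 ∉ B) := by
    rcases x with ⟨bx, x⟩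
    cases bx
    · simp only [tokenSucc_false, decide_eq_true_eq, decide_eq_false_iff_not]
      exact ⟨fun h h' => Finset.disjoint_left.1 hAB h' h, id⟩
    · simp only [tokenSucc_true, decide_eq_true_eq, decide_eq_false_iff_not, not_not]
      exact ⟨id, fun h => Finset.disjoint_left.1 hAB h⟩
  refine ⟨hv.1, hv.2, fun h => hx.2.2 ?_⟩
  exact tokenSucc_inj hf hg _ _ hv.1 hv.2 hx.1 hx.2.1 h

theorem tokenSucc_adj (hf : G.IsLinkage B A f) (hg : G.IsLinkage A B g)
    (x : Bool × V) (hx : x ∈ tokens A B f g) : G.Adj x.2 (tokenSucc A B f g x).2 := by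
  rw [mem_tokens] at hx
  obtain ⟨h1, h2, h3⟩ := hx
  rcases x with ⟨bx, x⟩
  cases bx
  · refine (hg.adj x (h2 rfl)).resolve_left fun h => h3 ?_
    rw [tokenSucc_false, h]
    simpa using h2 rfl
  · refine (hf.adj x (h1 rfl)).resolve_left fun h => h3 ?_
    rw [tokenSucc_true, h]
    simpa using h1 rfl

/-- The time `t` is the first one at which the flag is `false`, that is, the arrival in `A`. It
exists since otherwise the orbit would return to `b` by a step of `f`, which never enters `B`. -/
theorem exists_hitting_time (hf : G.IsLinkage B A f) (hg : G.IsLinkage A B g)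
    (hAB : Disjoint A B) {b : V} (hb : b ∈ B) :
    (true, b) ∈ tokens A B f g ∧ ∃ t : ℕ, ((tokenSucc A B f g)^[t] (true, b)).2 ∈ A ∧
      ∀ i, 0 < i → i ≤ t → ((tokenSucc A B f g)^[i] (true, b)).2 ∉ B := by
  have hbA : b ∉ A := fun h => Finset.disjoint_left.1 hAB h hb
  have hmem : (true, b) ∈ tokens A B f g := by
    refine mem_tokens.2 ⟨fun _ => hbA, by simp, fun h => ?_⟩
    have : f b = b := congrArg Prod.snd h
    exact hf.notMem b hbA (this.symm ▸ hb)
  refine ⟨hmem, ?_⟩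
  have hit := fun i => iterate_mem (tokenSucc_mem hf hg hAB) hmem i
  have hstep : ∀ i, ((tokenSucc A B f g)^[i] (true, b)).1 = true →
      ((tokenSucc A B f g)^[i + 1] (true, b)).2 ∉ B ∧
      (((tokenSucc A B f g)^[i + 1] (true, b)).1 = false →
        ((tokenSucc A B f g)^[i + 1] (true, b)).2 ∈ A) := by
    intro i hi
    have h1 := mem_tokens.1 (hit i)
    rw [Function.iterate_succ_apply']
    rcases hx : (tokenSucc A B f g)^[i] (true, b) with ⟨c, x⟩
    rw [hx] at hi h1
    obtain rfl : c = true := hi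
    rw [tokenSucc_true]
    exact ⟨hf.notMem x (h1.1 rfl), by simp⟩
  have hex : ∃ t, ((tokenSucc A B f g)^[t] (true, b)).1 = false := by
    by_contra! hcon
    have htrue : ∀ i, ((tokenSucc A B f g)^[i] (true, b)).1 = true := fun i => by
      simpa using hcon i
    have hpos := minimalPeriod_pos_of_injOn (tokenSucc_mem hf hg hAB)
      (fun x hx y hy => tokenSucc_inj hf hg x y (mem_tokens.1 hx).1 (mem_tokens.1 hx).2.1
        (mem_tokens.1 hy).1 (mem_tokens.1 hy).2.1) hmem
    have h1 := (hstep (Function.minimalPeriod (tokenSucc A B f g) (true, b) - 1) (htrue _)).1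
    rw [Nat.sub_add_cancel hpos, Function.iterate_minimalPeriod] at h1
    exact h1 hb
  have ht := Nat.find_spec hex
  have hmin : ∀ i < Nat.find hex, ((tokenSucc A B f g)^[i] (true, b)).1 = true := fun i hi => by
    simpa using Nat.find_min hex hi
  have htpos : 0 < Nat.find hex := by
    rw [Nat.pos_iff_ne_zero]
    intro h0
    rw [h0] at ht
    simp at ht
  refine ⟨Nat.find hex, ?_, fun i hi hit' => ?_⟩
  · have := (hstep (Nat.find hex - 1) (hmin _ (by omega))).2
    rw [Nat.sub_add_cancel htpos] at this
    exact this ht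
  · have := (hstep (i - 1) (hmin _ (by omega))).1
    rwa [Nat.sub_add_cancel hi] at this

/-- A linkage from `B` to `A` and a linkage from `A` to `B` give a thread that contains almost all
paths of the first linkage. -/
theorem exists_thread [Nonempty V] {p k : ℕ} (hG : ¬ G.HasCyclePacking p k) (hp : 2 ≤ p)
    (hf : G.IsLinkage B A f) (hg : G.IsLinkage A B g) (hAB : Disjoint A B) :
    ∃ T : Thread G (A : Set V) (B : Set V), T.MultLE 2 ∧ T.breaks.card < p * k ∧
      B.card ≤ T.J.card + p * k := by
  set s := tokenSucc A B f g with hs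
  set S := tokens A B f g with hS
  have hmap : ∀ x ∈ S, s x ∈ S := tokenSucc_mem hf hg hAB
  have hinj : ∀ x ∈ S, ∀ y ∈ S, s x = s y → x = y := fun x hx y hy =>
    tokenSucc_inj hf hg x y (mem_tokens.1 hx).1 (mem_tokens.1 hx).2.1
        (mem_tokens.1 hy).1 (mem_tokens.1 hy).2.1
  obtain ⟨e, β, reps, h1, h2, h3, h4, h5, h6, h7⟩ := exists_orbit_enumeration s S hmap hinj
  -- Each orbit is a closed walk. Distinct orbits share no token and a vertex carries only two
  -- tokens, so `p * k` orbits would give a packing.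
  have hβ : β.card < p * k := by
    by_contra! hle
    refine hG (hasCyclePacking_of_family (by omega) reps (fun x => {v | ∃ i, (s^[i] x).2 = v})
      (by omega) (fun x hx => ?_) fun v t hts ht => ?_)
    · have hpos := minimalPeriod_pos_of_injOn hmap hinj (h6 hx)
      refine ⟨x.2, ?_⟩
      have := transGen_adjOn_of_seq (G := G) (S := {v | ∃ i, (s^[i] x).2 = v})
        (fun i => (s^[i] x).2) hpos (fun i _ _ => ?_) fun i _ _ => ⟨i, rfl⟩
      · simpa [Function.iterate_minimalPeriod] using this
      · simp only [Function.iterate_succ_apply']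
        exact tokenSucc_adj hf hg _ (iterate_mem hmap (h6 hx) i)
    · have hc : ∀ x, ∃ i, x ∈ t → (s^[i] x).2 = v := by
        intro x
        by_cases hx : x ∈ t
        · obtain ⟨i, hi⟩ := ht x hx
          exact ⟨i, fun _ => hi⟩
        · exact ⟨0, fun h => (hx h).elim⟩
      choose c hc using hc
      have hinj' : Set.InjOn (fun x => s^[c x] x) t := by
        intro x hx y hy hxy
        by_contra hne
        exact h7 x (hts hx) y (hts hy) hne _ _ hxy
      rw [← Finset.card_image_of_injOn hinj']
      refine (card_tokens_label_le v _ fun x hx => ?_).trans hp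
      obtain ⟨y, hy, rfl⟩ := Finset.mem_image.1 hx
      exact hc y hy
  have hT : ∀ b, ∃ t l : ℕ, b ∈ B → (l < S.card ∧ e l = (true, b)) ∧ (s^[t] (true, b)).2 ∈ A ∧
      ∀ i, 0 < i → i ≤ t → (s^[i] (true, b)).2 ∉ B := by
    intro b
    by_cases hb : b ∈ B
    · obtain ⟨hm, t, ht⟩ := exists_hitting_time hf hg hAB hb
      obtain ⟨l, hl⟩ := h3 _ hm
      exact ⟨t, l, fun _ => ⟨hl, ht⟩⟩
    · exact ⟨0, 0, fun h => (hb h).elim⟩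
  choose t lo hT using hT
  have hwalk : ∀ b ∈ B, ∀ i, (∀ j, lo b ≤ j → j < lo b + i → j ∉ β) →
      lo b + i < S.card ∧ e (lo b + i) = s^[i] (true, b) := by
    intro b hb i
    induction i with
    | zero => exact fun _ => (hT b hb).1
    | succ i ih =>
      intro hfree
      obtain ⟨h8, h9⟩ := ih fun j hj hj' => hfree j hj (by omega)
      obtain ⟨h10, h11⟩ := h4 _ h8 (hfree _ (by omega) (by omega))
      refine ⟨h10, ?_⟩
      rw [Function.iterate_succ_apply', ← h9]
      exact h11
  -- The path from `b` reaches `A` before it can revisit `B`, so its interval ends before the next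
  -- start unless a break intervenes.
  have hsep : ∀ b ∈ B, ∀ b' ∈ B, lo b < lo b' → (∀ j, lo b ≤ j → j < lo b' → j ∉ β) →
      lo b + t b < lo b' := by
    intro b hb b' hb' hlt hfree
    by_contra! hle
    obtain ⟨_, h9⟩ := hwalk b hb (lo b' - lo b) fun j hj hj' => hfree j hj (by omega)
    rw [show lo b + (lo b' - lo b) = lo b' by omega, (hT b' hb').1.2] at h9
    refine (hT b hb).2.2 (lo b' - lo b) (by omega) (by omega) ?_
    rw [← h9]
    exact hb'
  have hloinj : ∀ b ∈ B, ∀ b' ∈ B, lo b = lo b' → b = b' := by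
    intro b hb b' hb' h
    have := (hT b hb).1.2
    rw [h, (hT b' hb').1.2] at this
    exact (congrArg Prod.snd this).symm
  set good := B.filter fun b => ∀ j, lo b ≤ j → j < lo b + t b → j ∉ β with hgood
  have hlab : ∀ b ∈ good, (e (lo b)).2 = b := fun b hb => by
    rw [(hT b (Finset.mem_filter.1 hb).1).1.2]
  refine ⟨⟨fun i => (e i).2, S.card, β, good.image lo, fun j => j + t (e j).2,
    fun i hi hiβ => ?_, fun j _ => Nat.le_add_right _ _, ?_, ?_, ?_, ?_, ?_⟩, fun v => ?_, hβ, ?_⟩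
  · rw [(h4 i (by omega) hiβ).2]
    exact tokenSucc_adj hf hg _ (h1 i (by omega))
  · intro j hj
    obtain ⟨b, hb, rfl⟩ := Finset.mem_image.1 hj
    rw [hlab b hb]
    exact (hwalk b (Finset.mem_filter.1 hb).1 _ (Finset.mem_filter.1 hb).2).1
  · intro j hj
    obtain ⟨b, hb, rfl⟩ := Finset.mem_image.1 hj
    rw [hlab b hb]
    exact (Finset.mem_filter.1 hb).2
  · intro j hj j' hj' hlt
    obtain ⟨b, hb, rfl⟩ := Finset.mem_image.1 hj
    obtain ⟨b', hb', rfl⟩ := Finset.mem_image.1 hj'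
    rw [hlab b hb]
    by_contra! hle
    refine absurd (hsep b (Finset.mem_filter.1 hb).1 b' (Finset.mem_filter.1 hb').1 hlt
      fun j h8 h9 => (Finset.mem_filter.1 hb).2 j h8 (by omega)) (by omega)
  · intro j hj
    obtain ⟨b, hb, rfl⟩ := Finset.mem_image.1 hj
    rw [hlab b hb]
    exact (Finset.mem_filter.1 hb).1
  · intro j hj
    obtain ⟨b, hb, rfl⟩ := Finset.mem_image.1 hj
    rw [hlab b hb, (hwalk b (Finset.mem_filter.1 hb).1 _ (Finset.mem_filter.1 hb).2).2]
    exact (hT b (Finset.mem_filter.1 hb).1).2.1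
  · have hinj' : Set.InjOn e ((Finset.range S.card).filter fun i => (e i).2 = v : Finset ℕ) := by
      intro i hi j hj hij
      rw [Finset.mem_coe, Finset.mem_filter, Finset.mem_range] at hi hj
      exact h2 i hi.1 j hj.1 hij
    change ((Finset.range S.card).filter fun i => (e i).2 = v).card ≤ 2
    rw [← Finset.card_image_of_injOn hinj']
    refine card_tokens_label_le v _ fun x hx => ?_
    obtain ⟨y, hy, rfl⟩ := Finset.mem_image.1 hx
    exact (Finset.mem_filter.1 hy).2
  · change B.card ≤ (good.image lo).card + p * k
    rw [Finset.card_image_of_injOn fun b hb b' hb' =>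
      hloinj b (Finset.mem_filter.1 hb).1 b' (Finset.mem_filter.1 hb').1]
    -- A spoilt interval is charged to its first break. By `hsep` no two intervals share the same
    -- first break.
    have hbad : (B.filter fun b => ¬ ∀ j, lo b ≤ j → j < lo b + t b → j ∉ β).card ≤ β.card := by
      have hex : ∀ b, ∃ j, b ∈ (B.filter fun b => ¬ ∀ j, lo b ≤ j → j < lo b + t b → j ∉ β) →
          (lo b ≤ j ∧ j < lo b + t b ∧ j ∈ β) ∧ ∀ i, lo b ≤ i → i < j → i ∉ β := by
        intro b
        by_cases hb : ∃ j, lo b ≤ j ∧ j < lo b + t b ∧ j ∈ β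
        · refine ⟨Nat.find hb, fun _ => ⟨Nat.find_spec hb, fun i hi hi' hiβ => ?_⟩⟩
          have := (Nat.find_spec hb).2.1
          exact Nat.find_min hb hi' ⟨hi, by omega, hiβ⟩
        · refine ⟨0, fun h => (hb ?_).elim⟩
          have := (Finset.mem_filter.1 h).2
          push Not at this
          exact this
      choose br hbr using hex
      have hlt : ∀ b ∈ (B.filter fun b => ¬ ∀ j, lo b ≤ j → j < lo b + t b → j ∉ β),
          ∀ b' ∈ (B.filter fun b => ¬ ∀ j, lo b ≤ j → j < lo b + t b → j ∉ β),
          br b = br b' → ¬ lo b < lo b' := by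
        intro b hb b' hb' heq hlt
        have h8 := hbr b hb
        have h9 := hbr b' hb'
        have := hsep b (Finset.mem_filter.1 hb).1 b' (Finset.mem_filter.1 hb').1 hlt
          fun j hj hj' => h8.2 j hj (by omega)
        omega
      refine Finset.card_le_card_of_injOn br (fun b hb => (hbr b hb).1.2.2) fun b hb b' hb' heq => ?_
      refine hloinj b (Finset.mem_filter.1 hb).1 b' (Finset.mem_filter.1 hb').1 ?_
      have h8 := hlt b hb b' hb' heq
      have h9 := hlt b' hb' b hb heq.symm
      omega
    have := Finset.card_filter_add_card_filter_not (s := B)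
      (fun b => ∀ j, lo b ≤ j → j < lo b + t b → j ∉ β)
    omega

end Tokens

/-- A long thread contains a long thread without breaks and repeated vertices. -/
theorem Thread.exists_path {G : Digraph V} {A B : Set V} {p k s : ℕ}
    (hG : ¬ G.HasCyclePacking p k) (hp : 2 ≤ p) (T : Thread G A B) (hT : T.MultLE 2)
    (hb : T.breaks.card < p * k) (hs : 0 < s) (hJ : 2 * (p * k) * s < T.J.card) :
    ∃ T' : Thread G A B, T'.MultLE 1 ∧ T'.breaks.card = 0 ∧ s ≤ T'.J.card := by
  -- `L` lists the starts of the intervals in increasing order. Block `g` consists of the positions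
  -- from `L (g * s)` up to but excluding `L ((g + 1) * s)`, and contains `s` whole intervals.
  set L : ℕ → ℕ := fun i => if h : i < T.J.card then T.J.orderEmbOfFin rfl ⟨i, h⟩ else 0 with hL
  have hLJ : ∀ i < T.J.card, L i ∈ T.J := by
    intro i hi
    simp only [hL, hi, dif_pos]
    exact Finset.orderEmbOfFin_mem _ _ _
  have hLlt : ∀ i j, i < j → j < T.J.card → L i < L j := by
    intro i j hij hj
    simp only [hL, hj, hij.trans hj, dif_pos]
    exact (T.J.orderEmbOfFin rfl).strictMono hij
  have hLle : ∀ i j, i ≤ j → j < T.J.card → L i ≤ L j := by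
    intro i j hij hj
    rcases hij.eq_or_lt with rfl | h
    · exact le_rfl
    · exact (hLlt i j h hj).le
  have hgs : ∀ g < 2 * (p * k), (g + 1) * s < T.J.card := fun g hg =>
    (Nat.mul_le_mul_right s hg).trans_lt hJ
  have hblock : ∀ g < 2 * (p * k), L (g * s) < L ((g + 1) * s) := fun g hg =>
    hLlt _ _ (Nat.mul_lt_mul_of_pos_right (Nat.lt_succ_self g) hs) (hgs g hg)
  have hLN : ∀ i < T.J.card, L i < T.N := fun i hi =>
    (T.le_hi _ (hLJ i hi)).trans_lt (T.hi_lt _ (hLJ i hi))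
  have hd : ∀ i ∈ Finset.range (2 * (p * k)), ∀ j ∈ Finset.range (2 * (p * k)), i ≠ j →
      L ((i + 1) * s) - 1 < L (j * s) ∨ L ((j + 1) * s) - 1 < L (i * s) := by
    have key : ∀ i j, i < j → j < 2 * (p * k) → L ((i + 1) * s) - 1 < L (j * s) := by
      intro i j hij hj
      have h1 := hblock i (hij.trans hj)
      have h2 := hLle ((i + 1) * s) (j * s) (Nat.mul_le_mul_right s hij)
        ((Nat.mul_le_mul_right s (Nat.le_succ j)).trans_lt (hgs j hj))
      omega
    intro i hi j hj hij
    rw [Finset.mem_range] at hi hj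
    rcases Nat.lt_or_gt_of_ne hij with h | h
    · exact Or.inl (key i j h hj)
    · exact Or.inr (key j i h hi)
  set broken := (Finset.range (2 * (p * k))).filter fun g =>
    ∃ z ∈ T.breaks, L (g * s) ≤ z ∧ z ≤ L ((g + 1) * s) - 1 with hbroken
  have hbc : broken.card ≤ T.breaks.card := card_filter_interval_le _ _ _ hd _
  -- At least `p * k` of the blocks have no break. If each of them repeated a vertex, each would
  -- contain a closed walk, and the blocks have congestion at most 2.
  obtain ⟨g, hg, hginj⟩ : ∃ g ∈ Finset.range (2 * (p * k)) \ broken, ∀ x y, L (g * s) ≤ x →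
      x < y → y < L ((g + 1) * s) → T.w x ≠ T.w y := by
    by_contra! hcon
    have hcon' : ∀ g, ∃ x y, g ∈ Finset.range (2 * (p * k)) \ broken → L (g * s) ≤ x ∧ x < y ∧
        y < L ((g + 1) * s) ∧ T.w x = T.w y := by
      intro g
      by_cases hg : g ∈ Finset.range (2 * (p * k)) \ broken
      · obtain ⟨x, y, h⟩ := hcon g hg
        exact ⟨x, y, fun _ => h⟩
      · exact ⟨0, 0, fun h => (hg h).elim⟩
    choose x y hxy using hcon'
    have hcard := Finset.le_card_sdiff broken (Finset.range (2 * (p * k)))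
    rw [Finset.card_range] at hcard
    refine hG (hasCyclePacking_of_family (by omega) (Finset.range (2 * (p * k)) \ broken)
      (fun g => {v | ∃ z ∈ Finset.range T.N, (L (g * s) ≤ z ∧ z ≤ L ((g + 1) * s) - 1) ∧
        T.w z = v}) (by omega) (fun g hg => ?_) fun v t hts ht => ?_)
    · obtain ⟨h1, h2, h3, h4⟩ := hxy g hg
      rw [Finset.mem_sdiff, Finset.mem_range] at hg
      have h5 := hLN _ (hgs g hg.1)
      refine ⟨T.w (x g), ?_⟩
      have := transGen_adjOn_of_seq (G := G) (S := {v | ∃ z ∈ Finset.range T.N,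
        (L (g * s) ≤ z ∧ z ≤ L ((g + 1) * s) - 1) ∧ T.w z = v}) T.w h2
        (fun i hi hi' => T.adj i (by omega) fun hiβ => hg.2 (Finset.mem_filter.2
          ⟨Finset.mem_range.2 hg.1, i, hiβ, by omega, by omega⟩))
        fun i hi hi' => ⟨i, Finset.mem_range.2 (by omega), ⟨by omega, by omega⟩, rfl⟩
      rwa [← h4] at this
    · refine le_trans (Finset.card_le_card fun i hi => ?_)
        (((card_filter_interval_le _ _ _ hd _).trans (hT v)).trans hp)
      obtain ⟨z, h1, h2, h3⟩ := ht i hi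
      exact Finset.mem_filter.2 ⟨(Finset.mem_sdiff.1 (hts hi)).1, z,
        Finset.mem_filter.2 ⟨h1, h3⟩, h2⟩
  rw [Finset.mem_sdiff, Finset.mem_range] at hg
  obtain ⟨hg, hgb⟩ := hg
  have hgN := hLN _ (hgs g hg)
  have hfree : ∀ i, L (g * s) ≤ i → i < L ((g + 1) * s) → i ∉ T.breaks := fun i h1 h2 hi =>
    hgb (Finset.mem_filter.2 ⟨Finset.mem_range.2 hg, i, hi, h1, by omega⟩)
  have hidx : ∀ i < s, g * s + i < T.J.card ∧ L (g * s) ≤ L (g * s + i) ∧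
      T.hi (L (g * s + i)) < L ((g + 1) * s) := by
    intro i hi
    have h1 := hgs g hg
    have h2 : (g + 1) * s = g * s + s := by ring
    refine ⟨by omega, hLle _ _ (by omega) (by omega), ?_⟩
    refine (T.disj _ (hLJ (g * s + i) (by omega)) _ (hLJ (g * s + i + 1) (by omega))
      (hLlt _ _ (by omega) (by omega))).trans_le (hLle _ _ (by omega) (by omega))
  have hJ' : ∀ j ∈ (Finset.range s).image (fun i => L (g * s + i) - L (g * s)),
      j + L (g * s) ∈ T.J ∧ T.hi (j + L (g * s)) < L ((g + 1) * s) := by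
    intro j hj
    obtain ⟨i, hi, rfl⟩ := Finset.mem_image.1 hj
    obtain ⟨h1, h2, h3⟩ := hidx i (Finset.mem_range.1 hi)
    rw [Nat.sub_add_cancel h2]
    exact ⟨hLJ _ h1, h3⟩
  have hback : ∀ j ∈ (Finset.range s).image (fun i => L (g * s + i) - L (g * s)),
      T.hi (j + L (g * s)) - L (g * s) + L (g * s) = T.hi (j + L (g * s)) := by
    intro j hj
    have := T.le_hi _ (hJ' j hj).1
    omega
  refine ⟨⟨fun i => T.w (i + L (g * s)), L ((g + 1) * s) - L (g * s), ∅,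
    (Finset.range s).image (fun i => L (g * s + i) - L (g * s)),
    fun j => T.hi (j + L (g * s)) - L (g * s), fun i hi _ => ?_, fun j hj => ?_, fun j hj => ?_,
    fun _ _ _ _ _ => Finset.notMem_empty _, fun j hj j' hj' hlt => ?_, fun j hj => ?_,
    fun j hj => ?_⟩, fun v => ?_, rfl, ?_⟩
  · rw [show i + 1 + L (g * s) = i + L (g * s) + 1 by omega]
    exact T.adj _ (by omega) (hfree _ (by omega) (by omega))
  · have := T.le_hi _ (hJ' j hj).1
    omega
  · have h1 := T.le_hi _ (hJ' j hj).1
    have h2 := (hJ' j hj).2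
    omega
  · have h1 := T.le_hi _ (hJ' j hj).1
    have h2 := T.disj _ (hJ' j hj).1 _ (hJ' j' hj').1 (by omega)
    omega
  · exact T.start_mem _ (hJ' j hj).1
  · rw [hback j hj]
    exact T.end_mem _ (hJ' j hj).1
  · rw [Finset.card_le_one]
    intro i hi j hj
    rw [Finset.mem_filter, Finset.mem_range] at hi hj
    simp only [] at hi hj
    have h0 := hi.2.trans hj.2.symm
    rcases lt_trichotomy i j with h | h | h
    · exact (hginj _ _ (by omega) (by omega) (by omega) h0).elim
    · exact h
    · exact (hginj _ _ (by omega) (by omega) (by omega) h0.symm).elim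
  · change s ≤ ((Finset.range s).image (fun i => L (g * s + i) - L (g * s))).card
    rw [Finset.card_image_of_injOn, Finset.card_range]
    intro i hi j hj hij
    rw [Finset.mem_coe, Finset.mem_range] at hi hj
    obtain ⟨h1, h2, _⟩ := hidx i hi
    obtain ⟨h3, h4, _⟩ := hidx j hj
    simp only [] at hij
    rcases lt_trichotomy i j with h | h | h
    · have := hLlt (g * s + i) (g * s + j) (by omega) h3
      omega
    · exact h
    · have := hLlt (g * s + j) (g * s + i) (by omega) h1
      omega

/-! ### A path through all sets of a bramble -/

/-- A shortest walk from `a` to the set `X` is a path that meets `X` only at its end. -/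
theorem exists_path_to_set {r : V → V → Prop} {a b : V} {X : Set V} (hab : ReflTransGen r a b)
    (hb : b ∈ X) : ∃ (m : ℕ) (u : ℕ → V), u 0 = a ∧ u m ∈ X ∧ (∀ i < m, u i ∉ X) ∧
      (∀ i < m, r (u i) (u (i + 1))) ∧ ∀ i ≤ m, ∀ j ≤ m, u i = u j → i = j := by
  have hex : ∃ m : ℕ, ∃ u : ℕ → V, u 0 = a ∧ u m ∈ X ∧ ∀ i < m, r (u i) (u (i + 1)) := by
    rcases reflTransGen_iff_eq_or_transGen.1 hab with rfl | h
    · exact ⟨0, fun _ => b, rfl, hb, fun i hi => by omega⟩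
    · obtain ⟨n, w, h0, h1, hw⟩ := h.exists_seq
      exact ⟨n + 1, w, h0, h1 ▸ hb, fun i hi => hw i (by omega)⟩
  obtain ⟨u, hu0, hum, hu⟩ := Nat.find_spec hex
  set m := Nat.find hex with hm
  have hmin : ∀ l < m, ¬ ∃ u : ℕ → V, u 0 = a ∧ u l ∈ X ∧ ∀ i < l, r (u i) (u (i + 1)) :=
    fun l hl => Nat.find_min hex hl
  have hne : ∀ i j, i < j → j ≤ m → u i ≠ u j := by
    intro i j hij hj heq
    refine hmin (m - (j - i)) (by omega) ⟨fun l => if l ≤ i then u l else u (l + (j - i)), by simp [hu0],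
      ?_, fun l hl => ?_⟩
    · by_cases h : m - (j - i) ≤ i
      · have h1 : m = j := by omega
        have h2 : m - (j - i) = i := by omega
        simp only [h2, le_refl, if_true]
        rw [heq, ← h1]
        exact hum
      · simp only [h, if_false]
        rwa [show m - (j - i) + (j - i) = m by omega]
    · rcases lt_trichotomy l i with h | h | h
      · have h1 : l ≤ i := h.le
        have h2 : l + 1 ≤ i := h
        simp only [h1, h2, if_true]
        exact hu l (by omega)
      · subst h
        have h2 : ¬ l + 1 ≤ l := by omega
        simp only [h2, le_refl, if_true, if_false]
        rw [heq, show l + 1 + (j - l) = j + 1 by omega]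
        exact hu j (by omega)
      · have h1 : ¬ l ≤ i := by omega
        have h2 : ¬ l + 1 ≤ i := by omega
        simp only [h1, h2, if_false]
        rw [show l + 1 + (j - i) = l + (j - i) + 1 by omega]
        exact hu _ (by omega)
  refine ⟨m, u, hu0, hum, fun i hi hiX => hmin i hi ⟨u, hu0, hiX, fun l hl => hu l (by omega)⟩, hu,
    fun i hi j hj h => ?_⟩
  rcases lt_trichotomy i j with hlt | h0 | hlt
  · exact (hne i j hlt hj h).elim
  · exact h0
  · exact (hne j i hlt hi h.symm).elim

section BramblePath

variable {G : Digraph V} {𝓑 : Set (Set V)} {n : ℕ}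

theorem IsBramble.nonempty (hB : G.IsBramble 𝓑 n) (hn : 0 < n) : Nonempty V := by
  obtain ⟨U, hU, _⟩ := hB.order ∅ (by simpa using hn)
  obtain ⟨x, _⟩ := hB.inter U hU U hU
  exact ⟨x⟩

/-- A longest path is taken among those that meet some bramble set `U` exactly in their last vertex.
If it missed a bramble set `U'`, it could be continued inside `U` until it first reaches `U'`, and
would be longer. -/
theorem IsBramble.exists_hitting_path [Fintype V] (hB : G.IsBramble 𝓑 n) (hn : 0 < n) :
    ∃ (w : ℕ → V) (N : ℕ), (∀ i < N, ∀ j < N, w i = w j → i = j) ∧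
      (∀ i, i + 1 < N → G.Adj (w i) (w (i + 1))) ∧ ∀ U ∈ 𝓑, ∃ i < N, w i ∈ U := by
  let P : ℕ → Prop := fun N => ∃ w : ℕ → V, (∀ i ≤ N, ∀ j ≤ N, w i = w j → i = j) ∧
    (∀ i < N, G.Adj (w i) (w (i + 1))) ∧ ∃ U ∈ 𝓑, w N ∈ U ∧ ∀ i < N, w i ∉ U
  have hP0 : P 0 := by
    obtain ⟨U, hU, _⟩ := hB.order ∅ (by simpa using hn)
    obtain ⟨x, hx, _⟩ := hB.inter U hU U hU
    exact ⟨fun _ => x, fun i hi j hj _ => by omega, fun i hi => by omega, U, hU, hx,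
      fun i hi => by omega⟩
  have hbound : ∀ N, P N → N ≤ Fintype.card V := by
    rintro N ⟨w, hw, _⟩
    have h1 : ((Finset.range (N + 1)).image w).card = N + 1 := by
      rw [Finset.card_image_of_injOn, Finset.card_range]
      intro i hi j hj h
      rw [Finset.mem_coe, Finset.mem_range] at hi hj
      exact hw i (by omega) j (by omega) h
    have h2 := Finset.card_le_univ ((Finset.range (N + 1)).image w)
    omega
  set N := Nat.findGreatest P (Fintype.card V) with hN
  obtain ⟨w, hw, hadj, U, hU, hNU, hiU⟩ : P N := Nat.findGreatest_spec (Nat.zero_le _) hP0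
  refine ⟨w, N + 1, fun i hi j hj => hw i (by omega) j (by omega),
    fun i hi => hadj i (by omega), ?_⟩
  by_contra! hcon
  obtain ⟨U', hU', hmiss⟩ := hcon
  obtain ⟨x, hx, hx'⟩ := hB.inter U hU U' hU'
  obtain ⟨m, u, hu0, hum, hui, hustep, huinj⟩ := exists_path_to_set (hB.conn U hU _ hNU _ hx) hx'
  have hmpos : 0 < m := by
    rw [Nat.pos_iff_ne_zero]
    rintro rfl
    exact hmiss N (by omega) (hu0 ▸ hum)
  have huU : ∀ i ≤ m, u i ∈ U := by
    intro i hi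
    rcases Nat.eq_zero_or_pos i with rfl | h
    · rwa [hu0]
    · have := (hustep (i - 1) (by omega)).2.2
      rwa [Nat.sub_add_cancel h] at this
  have hPm : P (N + m) := by
    refine ⟨fun i => if i < N then w i else u (i - N), fun i hi j hj h => ?_, fun i hi => ?_,
      U', hU', ?_, fun i hi => ?_⟩
    · by_cases h1 : i < N <;> by_cases h2 : j < N <;> simp only [h1, h2, if_true, if_false] at h
      · exact hw i (by omega) j (by omega) h
      · exact (hiU i h1 (h ▸ huU (j - N) (by omega))).elim
      · exact (hiU j h2 (h ▸ huU (i - N) (by omega))).elim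
      · have := huinj _ (by omega) _ (by omega) h
        omega
    · rcases lt_trichotomy (i + 1) N with h | h | h
      · have h1 : i < N := by omega
        simp only [h, h1, if_true]
        exact hadj i h1
      · have h1 : i < N := by omega
        have h2 : ¬ i + 1 < N := by omega
        simp only [h1, h2, if_true, if_false]
        rw [show i + 1 - N = 0 by omega, hu0, ← h]
        exact hadj i h1
      · have h1 : ¬ i < N := by omega
        have h2 : ¬ i + 1 < N := by omega
        simp only [h1, h2, if_false]
        rw [show i + 1 - N = i - N + 1 by omega]
        exact (hustep (i - N) (by omega)).1
    · have h1 : ¬ N + m < N := by omega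
      simp only [h1, if_false]
      rwa [Nat.add_sub_cancel_left]
    · by_cases h1 : i < N
      · simp only [h1, if_true]
        exact hmiss i (by omega)
      · simp only [h1, if_false]
        exact hui _ (by omega)
  have := Nat.le_findGreatest (hbound _ hPm) hPm
  omega

/-- A sequence that meets all sets of a bramble can be cut into pieces none of which can be
separated from the bramble by fewer than `d` vertices. -/
theorem IsBramble.exists_cuts [Fintype V] (hB : G.IsBramble 𝓑 n) {w : ℕ → V} {N d : ℕ}
    (hw : ∀ U ∈ 𝓑, ∃ i < N, w i ∈ U) (j : ℕ) (hj : j * d ≤ n) :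
    ∃ c : ℕ → ℕ, c j ≤ N ∧ (∀ i < j, c i ≤ c (i + 1)) ∧
      (∀ i < j, ∀ X : Finset V, X.card < d → ∃ U ∈ 𝓑, (∀ x ∈ X, x ∉ U) ∧
        ∃ y, c i ≤ y ∧ y < c (i + 1) ∧ w y ∈ U) ∧
      ∃ H : Finset V, H.card ≤ j * d ∧ ∀ U ∈ 𝓑, (∃ y < c j, w y ∈ U) → ∃ h ∈ H, h ∈ U := by
  induction j with
  | zero =>
    exact ⟨fun _ => 0, Nat.zero_le _, fun i hi => by omega, fun i hi => by omega, ∅, by simp,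
      fun U _ ⟨y, hy, _⟩ => (Nat.not_lt_zero y hy).elim⟩
  | succ j ih =>
    have hj' : (j + 1) * d = j * d + d := Nat.succ_mul j d
    obtain ⟨c, hcN, hmono, hc, H, hH, hHU⟩ := ih (by omega)
    -- The next piece ends as early as possible. The remainder of the sequence qualifies, since `H ∪
    -- X` is too small to hit the bramble and `H` takes care of the sets met earlier.
    have hex : ∃ z, (c j ≤ z ∧ z ≤ N) ∧ ∀ X : Finset V, X.card < d → ∃ U ∈ 𝓑, (∀ x ∈ X, x ∉ U) ∧
        ∃ y, c j ≤ y ∧ y < z ∧ w y ∈ U := by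
      refine ⟨N, ⟨hcN, le_rfl⟩, fun X hX => ?_⟩
      have := Finset.card_union_le H X
      obtain ⟨U, hU, hUX⟩ := hB.order (H ∪ X) (by omega)
      obtain ⟨y, hy, hyU⟩ := hw U hU
      refine ⟨U, hU, fun x hx => hUX x (Finset.mem_union_right _ hx), y, ?_, hy, hyU⟩
      by_contra! hlt
      obtain ⟨h, hh, hhU⟩ := hHU U hU ⟨y, hlt, hyU⟩
      exact hUX h (Finset.mem_union_left _ hh) hhU
    obtain ⟨⟨hz1, hzN⟩, hz2⟩ := Nat.find_spec hex
    set z := Nat.find hex with hz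
    have hex' : ∃ H' : Finset V, H'.card ≤ (j + 1) * d ∧
        ∀ U ∈ 𝓑, (∃ y < z, w y ∈ U) → ∃ h ∈ H', h ∈ U := by
      rcases hz1.eq_or_lt with h0 | hlt
      · rw [← h0]
        exact ⟨H, by omega, hHU⟩
      have hmin := Nat.find_min hex (m := z - 1) (by omega)
      have : ∃ X : Finset V, X.card < d ∧ ∀ U ∈ 𝓑, (∀ x ∈ X, x ∉ U) →
          ∀ y, c j ≤ y → y < z - 1 → w y ∉ U := by
        by_contra! hcon
        exact hmin ⟨⟨by omega, by omega⟩, hcon⟩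
      obtain ⟨X, hX, hXU⟩ := this
      -- By minimality of `z`, fewer than `d` vertices `X` hit the sets met by the piece without its
      -- last vertex. Adding that vertex costs at most `d` in all.
      refine ⟨H ∪ insert (w (z - 1)) X, ?_, fun U hU ⟨y, hy, hyU⟩ => ?_⟩
      · have h1 := Finset.card_union_le H (insert (w (z - 1)) X)
        have h2 := Finset.card_insert_le (w (z - 1)) X
        omega
      · by_contra! hcon
        have h1 : ∀ x ∈ X, x ∉ U := fun x hx =>
          hcon x (Finset.mem_union_right _ (Finset.mem_insert_of_mem hx))
        have h2 : w (z - 1) ∉ U := hcon _ (Finset.mem_union_right _ (Finset.mem_insert_self _ _))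
        have h3 : y ≠ z - 1 := fun h => h2 (h ▸ hyU)
        by_cases hyc : y < c j
        · obtain ⟨h, hh, hhU⟩ := hHU U hU ⟨y, hyc, hyU⟩
          exact hcon h (Finset.mem_union_left _ hh) hhU
        · exact hXU U hU h1 y (by omega) (by omega) hyU
    have hle : ∀ i, i ≤ j → (if i ≤ j then c i else z) = c i := fun i hi => if_pos hi
    have hlast : (if j + 1 ≤ j then c (j + 1) else z) = z := if_neg (by omega)
    refine ⟨fun i => if i ≤ j then c i else z, ?_, fun i hi => ?_, fun i hi => ?_, ?_⟩
    · simp only [hlast]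
      exact hzN
    · rcases Nat.lt_succ_iff_lt_or_eq.1 hi with h | rfl
      · simp only [hle i h.le, hle (i + 1) h]
        exact hmono i h
      · simp only [hle i le_rfl, hlast]
        exact hz1
    · rcases Nat.lt_succ_iff_lt_or_eq.1 hi with h | rfl
      · simp only [hle i h.le, hle (i + 1) h]
        exact hc i h
      · simp only [hle i le_rfl, hlast]
        exact hz2
    · simp only [hlast]
      exact hex'

/-- A bramble of large order gives disjoint paths with sets `A i` and `B i` of `d` vertices on the
first and the second half, linked in both directions. -/
theorem IsBramble.exists_path_system [Fintype V] {r d : ℕ} (hr : 0 < r) (hd : 0 < d)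
    (hB : G.IsBramble 𝓑 (2 * r * d)) :
    ∃ (A B : Fin r → Finset V) (U : Fin r → Set V), (∀ i, (B i).card = d) ∧
      (∀ i, Disjoint (A i) (B i)) ∧ (∀ i, ∃ f, G.IsLinkage (B i) (A i) f) ∧
      (∀ i, ∃ g, G.IsLinkage (A i) (B i) g) ∧ (∀ i j, i ≠ j → Disjoint (U i) (U j)) ∧
      ∀ i, ∀ a ∈ A i, ∀ b ∈ B i, TransGen (G.AdjOn (U i)) a b := by
  obtain ⟨w, N, hinj, hadj, hw⟩ := hB.exists_hitting_path (by positivity)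
  obtain ⟨c, hcN, hmono, hc, -⟩ := hB.exists_cuts hw (2 * r) le_rfl
  have hmono' : ∀ i j, i ≤ j → j ≤ 2 * r → c i ≤ c j := by
    intro i j hij
    induction j, hij using Nat.le_induction with
    | base => exact fun _ => le_rfl
    | succ j _ ih => exact fun h => (ih (by omega)).trans (hmono j (by omega))
  have hd2 : 2 * d ≤ 2 * r * d := Nat.mul_le_mul_right d (by omega)
  have hset : ∀ i, ∃ A : Finset V, i < 2 * r → (∀ x ∈ A, ∃ y, c i ≤ y ∧ y < c (i + 1) ∧ w y = x) ∧
      A.card = d ∧ G.bramRank 𝓑 d A = d ∧ G.rev.bramRank 𝓑 d A = d := by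
    intro i
    by_cases hi : i < 2 * r
    · obtain ⟨A, hA, hA'⟩ := hB.exists_linked_subset hd2
        ((Finset.Ico (c i) (c (i + 1))).image w) (fun X hX => by
          obtain ⟨U, hU, hUX, y, h1, h2, h3⟩ := hc i hi X hX
          exact ⟨U, hU, hUX, w y, Finset.mem_image_of_mem w (Finset.mem_Ico.2 ⟨h1, h2⟩), h3⟩)
      refine ⟨A, fun _ => ⟨fun x hx => ?_, hA'⟩⟩
      obtain ⟨y, hy, rfl⟩ := Finset.mem_image.1 (hA hx)
      rw [Finset.mem_Ico] at hy
      exact ⟨y, hy.1, hy.2, rfl⟩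
    · exact ⟨∅, fun h => (hi h).elim⟩
  choose A hA using hset
  have hidx : ∀ i : Fin r, 2 * (i : ℕ) < 2 * r ∧ 2 * (i : ℕ) + 1 < 2 * r := fun i => by
    have := i.2
    omega
  have hlt : ∀ i < r, c (2 * i + 1 + 1) ≤ N := fun i hi => (hmono' _ _ (by omega) le_rfl).trans hcN
  -- Even pieces supply the sets `A`, odd pieces the sets `B`, and `U i` is the stretch of the path
  -- across both, along which `A i` reaches `B i`.
  refine ⟨fun i => A (2 * i), fun i => A (2 * i + 1),
    fun i => {v | ∃ y, c (2 * i) ≤ y ∧ y < c (2 * i + 1 + 1) ∧ w y = v}, fun i => ?_, fun i => ?_,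
    fun i => ?_, fun i => ?_, fun i j hij => ?_, fun i a ha b hb => ?_⟩
  · exact (hA _ (hidx i).2).2.1
  · rw [Finset.disjoint_left]
    intro x hx hx'
    obtain ⟨y, h1, h2, rfl⟩ := (hA _ (hidx i).1).1 x hx
    obtain ⟨z, h3, h4, h5⟩ := (hA _ (hidx i).2).1 _ hx'
    have h6 := hlt i i.2
    have := hinj z (by omega) y (by omega) h5
    omega
  · exact hB.exists_isLinkage (hA _ (hidx i).2).2.1 (hA _ (hidx i).1).2.1
      (hA _ (hidx i).2).2.2.1 (hA _ (hidx i).1).2.2.2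
  · exact hB.exists_isLinkage (hA _ (hidx i).1).2.1 (hA _ (hidx i).2).2.1
      (hA _ (hidx i).1).2.2.1 (hA _ (hidx i).2).2.2.2
  · rw [Set.disjoint_left]
    rintro x ⟨y, h1, h2, rfl⟩ ⟨z, h3, h4, h5⟩
    have h6 := hlt i i.2
    have h7 := hlt j j.2
    have h8 := hinj z (by omega) y (by omega) h5
    rcases lt_or_gt_of_ne hij with h | h
    · have := hmono' (2 * i + 1 + 1) (2 * j) (by omega) (by omega)
      omega
    · have := hmono' (2 * j + 1 + 1) (2 * i) (by omega) (by omega)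
      omega
  · obtain ⟨y, h1, h2, rfl⟩ := (hA _ (hidx i).1).1 a ha
    obtain ⟨z, h3, h4, rfl⟩ := (hA _ (hidx i).2).1 b hb
    have h6 := hlt i i.2
    exact transGen_adjOn_of_seq w (by omega) (fun l _ _ => hadj l (by omega))
      fun l _ _ => ⟨l, by omega, by omega, rfl⟩

/-! ### Cycle packings from brambles of large order -/

theorem IsBramble.hasCyclePacking_four [Fintype V] {k : ℕ}
    (hB : G.IsBramble 𝓑 (12544 * k ^ 3)) : G.HasCyclePacking 4 k := by
  by_contra hG
  have hk : 0 < k := by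
    rw [Nat.pos_iff_ne_zero]
    rintro rfl
    exact hG ⟨∅, rfl, by simp, by simp⟩
  have : Nonempty V := hB.nonempty (by positivity)
  -- With `r = 8 * k` threads and `b = 4 * k` breaks, `8 * r * (4 * k + 2 * b)` is `768 * k ^ 2`
  -- intervals. The surplus `16 * k ^ 2` in `d` covers the at most `4 * k` paths lost in
  -- `exists_thread`.
  obtain ⟨A, B, U, hBc, hAB, hf, hg, hU, hUt⟩ := IsBramble.exists_path_system (G := G) (𝓑 := 𝓑)
    (r := 2 * (4 * k)) (d := 784 * k ^ 2) (by positivity) (by positivity)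
    (by rw [show 2 * (2 * (4 * k)) * (784 * k ^ 2) = 12544 * k ^ 3 by ring]; exact hB)
  choose f hf using hf
  choose g hg using hg
  have hT := fun i => exists_thread hG (by omega) (hf i) (hg i) (hAB i)
  choose T hT2 hTb hTJ using hT
  refine hG (hasCyclePacking_of_threads (q := 2) (b := 4 * k) (s := 768 * k ^ 2) (by omega)
    (by omega) _ _ U T hT2 (fun i => (hTb i).le) (fun i => ?_) (by positivity) hU
    (fun i a ha b hb => hUt i a ha b hb) le_rfl ?_)
  · have h1 := hTJ i
    rw [hBc i] at h1
    have h2 : k ≤ k ^ 2 := Nat.le_self_pow (by omega) k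
    omega
  · exact le_of_eq (by ring)

theorem IsBramble.hasCyclePacking_two [Fintype V] {k : ℕ}
    (hB : G.IsBramble 𝓑 (2176 * k ^ 4)) : G.HasCyclePacking 2 k := by
  by_contra hG
  have hk : 0 < k := by
    rw [Nat.pos_iff_ne_zero]
    rintro rfl
    exact hG ⟨∅, rfl, by simp, by simp⟩
  have : Nonempty V := hB.nonempty (by positivity)
  -- With `r = 4 * k` threads and no breaks, `64 * k ^ 2` intervals suffice. `Thread.exists_path`
  -- needs more than `4 * k` times as many, `256 * k ^ 3`, and the surplus `16 * k ^ 3` covers the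
  -- loss in `exists_thread`.
  obtain ⟨A, B, U, hBc, hAB, hf, hg, hU, hUt⟩ := IsBramble.exists_path_system (G := G) (𝓑 := 𝓑)
    (r := 2 * (2 * k)) (d := 272 * k ^ 3) (by positivity) (by positivity)
    (by rw [show 2 * (2 * (2 * k)) * (272 * k ^ 3) = 2176 * k ^ 4 by ring]; exact hB)
  choose f hf using hf
  choose g hg using hg
  have hT := fun i => exists_thread hG le_rfl (hf i) (hg i) (hAB i)
  choose T hT2 hTb hTJ using hT
  have hT' := fun i => Thread.exists_path (s := 64 * k ^ 2) hG le_rfl (T i) (hT2 i) (hTb i)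
    (by positivity) (by
      have h1 := hTJ i
      rw [hBc i] at h1
      have h2 : k ≤ k ^ 3 := Nat.le_self_pow (by omega) k
      have h3 : 2 * (2 * k) * (64 * k ^ 2) = 256 * k ^ 3 := by ring
      omega)
  choose T' hT1 hTb' hTJ' using hT'
  refine hG (hasCyclePacking_of_threads (q := 1) (b := 0) (s := 64 * k ^ 2) le_rfl
    le_rfl _ _ U T' hT1 (fun i => (hTb' i).le) hTJ' (by positivity) hU
    (fun i a ha b hb => hUt i a ha b hb) le_rfl ?_)
  exact le_of_eq (by ring)

end BramblePath

/-! ### Arboreal decompositions -/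

/-- A rooted branching scheme of nested vertex sets gives an arboreal decomposition. -/
theorem exists_widthLE_of_branching [Finite V] {G : Digraph V} {σ : Type u} (root : σ)
    (S W Z : σ → Set V) (ch : σ → σ → Prop) (w : ℕ) (hroot : S root = Set.univ)
    (hW : ∀ s, (W s).Nonempty) (hWS : ∀ s, W s ⊆ S s)
    (hch : ∀ s t, ch s t → ∀ v ∈ S t, v ∈ S s ∧ v ∉ W s)
    (hex : ∀ s, ∀ v ∈ S s, v ∉ W s → ∃ t, ch s t ∧ v ∈ S t)
    (hun : ∀ s t t', ch s t → ch s t' → ∀ v ∈ S t, v ∈ S t' → t = t')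
    (hnorm : ∀ s t, ch s t → G.IsNormal (Z t) (S t))
    (hbag : ∀ s, ∃ Y : Set V, Y.ncard ≤ w + 1 ∧ W s ⊆ Y ∧ Z s ⊆ Y ∧ ∀ t, ch s t → Z t ⊆ Y) :
    ∃ D : G.ArborealDecomposition, D.WidthLE w := by
  have hmono : ∀ s t, ReflTransGen ch s t → S t ⊆ S s := by
    intro s t h
    induction h with
    | refl => exact subset_rfl
    | tail _ h ih => exact fun v hv => ih (hch _ _ h v hv).1
  have hcomp : ∀ s, ReflTransGen ch root s → ∀ s', ReflTransGen ch root s' → ∀ v ∈ S s, v ∈ S s' →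
      ReflTransGen ch s s' ∨ ReflTransGen ch s' s := by
    intro s hs s' hs' v
    induction hs with
    | refl => exact fun _ _ => Or.inl hs'
    | @tail s₀ s _ h ih =>
      intro hv hv'
      rcases ih (hch _ _ h v hv).1 hv' with h1 | h1
      · rcases ReflTransGen.cases_head h1 with rfl | ⟨s₁, h2, h3⟩
        · exact Or.inr (ReflTransGen.single h)
        · obtain rfl := hun _ _ _ h h2 v hv (hmono _ _ h3 hv')
          exact Or.inl h3
      · exact Or.inr (h1.tail h)
  have hdesc : ∀ v s, v ∈ S s → ∃ t, ReflTransGen ch s t ∧ v ∈ W t := by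
    intro v s hv
    induction hn : (S s).ncard using Nat.strong_induction_on generalizing s with
    | _ n ih =>
    by_cases hvW : v ∈ W s
    · exact ⟨s, ReflTransGen.refl, hvW⟩
    · obtain ⟨t, ht, hvt⟩ := hex s v hv hvW
      obtain ⟨x, hx⟩ := hW s
      have hlt : (S t).ncard < n := by
        rw [← hn]
        exact Set.ncard_lt_ncard ⟨fun y hy => (hch _ _ ht y hy).1,
          fun hsub => (hch _ _ ht x (hsub (hWS s hx))).2 hx⟩ (Set.toFinite _)
      obtain ⟨t', h1, h2⟩ := ih _ hlt t hvt rfl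
      exact ⟨t', ReflTransGen.head ht h1, h2⟩
  let T := {s : σ // ReflTransGen ch root s}
  let R : Digraph T := ⟨fun x y => ch x.1 y.1⟩
  have hlift : ∀ (x : T) (t : σ), ReflTransGen ch x.1 t → ∃ h, R.Reach x ⟨t, h⟩ := by
    intro x t h
    induction h with
    | refl => exact ⟨x.2, ReflTransGen.refl⟩
    | tail _ h ih =>
      obtain ⟨h1, h2⟩ := ih
      exact ⟨h1.tail h, ReflTransGen.tail h2 h⟩
  have hproj : ∀ x y : T, R.Reach x y → ReflTransGen ch x.1 y.1 := by
    intro x y h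
    induction h with
    | refl => exact ReflTransGen.refl
    | tail _ h ih => exact ih.tail h
  have hsne : ∀ s, (S s).Nonempty := fun s => (hW s).mono (hWS s)
  -- If `s'` were a proper descendant of `s`, then `t` would be the child of `s` on the way to `s'`.
  -- So `S t` would contain `W s'`, which children of `s'` avoid.
  have hparent : ∀ s s' t, ReflTransGen ch s s' → ch s t → ch s' t → s = s' := by
    intro s s' t h hs hs'
    rcases ReflTransGen.cases_head h with h1 | ⟨s₁, h2, h3⟩
    · exact h1
    · obtain ⟨v, hv⟩ := hsne t
      obtain rfl := hun _ _ _ hs h2 v hv (hmono _ _ h3 (hch _ _ hs' v hv).1)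
      obtain ⟨x, hx⟩ := hW s'
      exact ((hch _ _ hs' x (hmono _ _ h3 (hWS _ hx))).2 hx).elim
  have hWun : ∀ v s s', ReflTransGen ch s s' → v ∈ W s → v ∈ W s' → s = s' := by
    intro v s s' h hs hs'
    rcases ReflTransGen.cases_head h with h1 | ⟨s₁, h2, h3⟩
    · exact h1
    · exact ((hch _ _ h2 v (hmono _ _ h3 (hWS _ hs'))).2 hs).elim
  refine ⟨⟨T, R, ⟨root, ReflTransGen.refl⟩, ⟨?_, ?_, ?_⟩, fun t => W t.1, fun _ t => Z t.1,
    fun t => hW t.1, ?_, ?_⟩, ?_⟩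
  · intro s hs
    obtain ⟨x, hx⟩ := hW s.1
    exact (hch s.1 root hs x (hroot ▸ Set.mem_univ x)).2 hx
  · rintro ⟨t, ht⟩ hne
    rcases ReflTransGen.cases_tail ht with h | ⟨s, hs, hst⟩
    · exact (hne (Subtype.ext h)).elim
    · refine ⟨⟨s, hs⟩, hst, ?_⟩
      rintro ⟨s', hs'⟩ hst'
      obtain ⟨v, hv⟩ := hsne t
      refine Subtype.ext ?_
      rcases hcomp s hs s' hs' v (hch _ _ hst v hv).1 (hch _ _ hst' v hv).1 with h | h
      · exact (hparent _ _ _ h hst hst').symm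
      · exact hparent _ _ _ h hst' hst
  · rintro ⟨t, ht⟩
    obtain ⟨_, h⟩ := hlift ⟨root, ReflTransGen.refl⟩ t ht
    exact h
  · intro v
    obtain ⟨t, ht, hvt⟩ := hdesc v root (hroot ▸ Set.mem_univ v)
    refine ⟨⟨t, ht⟩, hvt, ?_⟩
    rintro ⟨t', ht'⟩ hvt'
    refine Subtype.ext ?_
    rcases hcomp t ht t' ht' v (hWS _ hvt) (hWS _ hvt') with h | h
    · exact (hWun v _ _ h hvt hvt').symm
    · exact hWun v _ _ h hvt' hvt
  · intro s t hst
    have : {v | ∃ t' : T, R.Reach t t' ∧ v ∈ W t'.1} = S t.1 := by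
      ext v
      constructor
      · rintro ⟨t', h, hv⟩
        exact hmono _ _ (hproj _ _ h) (hWS _ hv)
      · intro hv
        obtain ⟨t', h, hvt⟩ := hdesc v _ hv
        obtain ⟨h1, h2⟩ := hlift t t' h
        exact ⟨⟨t', h1⟩, h2, hvt⟩
    rw [this]
    exact hnorm _ _ hst
  · intro t
    obtain ⟨Y, hY, h1, h2, h3⟩ := hbag t.1
    refine (Set.ncard_le_ncard ?_ (Set.toFinite Y)).trans hY
    rintro v ((hv | ⟨s, _, hv⟩) | ⟨s, hs, hv⟩)
    · exact h1 hv
    · exact h2 hv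
    · exact h3 _ hs hv

/-! ### Strong components, balanced separators and the width bound -/

/-- The vertex set of the strong component of `v` in `G - Z`. -/
def strongComp (G : Digraph V) (Z : Set V) (v : V) : Set V :=
  {u | (G.deleteVerts Z).Reach v u ∧ (G.deleteVerts Z).Reach u v}

section StrongComp

variable {G : Digraph V} {Z Z' : Set V} {v : V}

theorem deleteVerts_reach_mono (h : Z ⊆ Z') {a b : V} (hab : (G.deleteVerts Z').Reach a b) :
    (G.deleteVerts Z).Reach a b :=
  ReflTransGen.mono (fun _ _ hxy => ⟨hxy.1, fun hx => hxy.2.1 (h hx), fun hy => hxy.2.2 (h hy)⟩)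
    _ _ hab

theorem strongComp_anti (h : Z ⊆ Z') : G.strongComp Z' v ⊆ G.strongComp Z v := fun _ hu =>
  ⟨deleteVerts_reach_mono h hu.1, deleteVerts_reach_mono h hu.2⟩

theorem mem_strongComp_self : v ∈ G.strongComp Z v := ⟨ReflTransGen.refl, ReflTransGen.refl⟩

theorem strongComp_eq {u : V} (h : u ∈ G.strongComp Z v) : G.strongComp Z u = G.strongComp Z v := by
  ext x
  exact ⟨fun hx => ⟨h.1.trans hx.1, hx.2.trans h.2⟩, fun hx => ⟨h.2.trans hx.1, hx.2.trans h.1⟩⟩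

theorem notMem_of_mem_strongComp (hv : v ∉ Z) {u : V} (hu : u ∈ G.strongComp Z v) : u ∉ Z := by
  rcases ReflTransGen.cases_tail hu.1 with h | ⟨x, _, hx⟩
  · rwa [h]
  · exact hx.2.2

/-- A walk of `G - Z'` between vertices of a strong component of `G - Z` stays in it. -/
theorem reflTransGen_in_strongComp (h : Z ⊆ Z') {a b c : V} (ha : a ∈ G.strongComp Z v)
    (hc : c ∈ G.strongComp Z v) (hab : (G.deleteVerts Z').Reach a b)
    (hbc : (G.deleteVerts Z').Reach b c) :
    ReflTransGen (fun x y => (G.deleteVerts Z').Adj x y ∧ x ∈ G.strongComp Z v ∧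
      y ∈ G.strongComp Z v) a b := by
  induction hab using ReflTransGen.head_induction_on with
  | refl => exact ReflTransGen.refl
  | @head a a' haa' ha'b ih =>
    have ha' : a' ∈ G.strongComp Z v :=
      ⟨ha.1.trans (deleteVerts_reach_mono h (ReflTransGen.single haa')),
        (deleteVerts_reach_mono h (ReflTransGen.trans ha'b hbc)).trans hc.2⟩
    exact ReflTransGen.head ⟨haa', ha, ha'⟩ (ih ha')

/-- Without a bramble of order `n`, every set `W` has a balanced separator. -/
theorem exists_balanced_separator [Finite V] {n : ℕ} (hn : ∀ 𝓑, ¬ G.IsBramble 𝓑 n) (W : Set V) :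
    ∃ X : Finset V, X.card < n ∧
      ∀ v ∉ X, 2 * (G.strongComp (X : Set V) v ∩ W).ncard ≤ W.ncard := by
  by_contra! hcon
  -- If no balanced separator exists, the components with more than half of `W` form a bramble: any
  -- two of them intersect within `W`.
  refine hn {U | ∃ (X : Finset V) (v : V), X.card < n ∧ v ∉ X ∧ U = G.strongComp (X : Set V) v ∧
    W.ncard < 2 * (U ∩ W).ncard} ⟨?_, ?_, ?_⟩
  · rintro _ ⟨X, v, _, _, rfl, _⟩ a ha b hb
    refine ReflTransGen.mono (fun x y hxy => ⟨hxy.1.1, hxy.2⟩) _ _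
      (reflTransGen_in_strongComp subset_rfl ha hb (ha.2.trans hb.1) ReflTransGen.refl)
  · rintro U ⟨_, _, _, _, _, hU⟩ U' ⟨_, _, _, _, _, hU'⟩
    by_contra hemp
    rw [Set.not_nonempty_iff_eq_empty, ← Set.disjoint_iff_inter_eq_empty] at hemp
    have h1 := Set.ncard_union_eq (s := U ∩ W) (t := U' ∩ W)
      (hemp.mono Set.inter_subset_left Set.inter_subset_left) (Set.toFinite _) (Set.toFinite _)
    have h2 := Set.ncard_le_ncard (s := (U ∩ W) ∪ (U' ∩ W)) (t := W)
      (Set.union_subset Set.inter_subset_right Set.inter_subset_right) (Set.toFinite _)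
    omega
  · intro X hX
    obtain ⟨v, hv, hlt⟩ := hcon X hX
    exact ⟨_, ⟨X, v, hX, hv, rfl, hlt⟩, fun x hx hxU =>
      notMem_of_mem_strongComp (Z := (X : Set V)) (by simpa using hv) hxU (by simpa using hx)⟩

/-- The directed treewidth is linear in the largest order of a bramble. -/
theorem directedTreewidth_le_of_forall_not_isBramble [Finite V] {n : ℕ}
    (hn : ∀ 𝓑, ¬ G.IsBramble 𝓑 n) : G.directedTreewidth ≤ 3 * n := by
  rcases isEmpty_or_nonempty V with hV | hV
  · have : {w : ℕ | ∃ D : G.ArborealDecomposition, D.WidthLE w} = ∅ := by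
      refine Set.eq_empty_of_forall_notMem ?_
      rintro w ⟨D, _⟩
      exact hV.elim (D.nonempty D.root).some
    rw [directedTreewidth, this, Nat.sInf_empty]
    exact Nat.zero_le _
  refine Nat.sInf_le ?_
  -- A state is a part `S` still to be decomposed with its guard `Z`. The set `X` chosen below
  -- balances `Z` and contains an extra vertex of `S`, so that `X ∩ S` is a nonempty bag.
  let σ := {q : Set V × Set V // q.1.Nonempty ∧ G.IsNormal q.2 q.1 ∧ q.2.ncard ≤ 2 * n}
  have hX : ∀ s : σ, ∃ X : Set V, X.ncard ≤ n ∧ (X ∩ s.1.1).Nonempty ∧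
      ∀ v ∉ X, 2 * (G.strongComp X v ∩ s.1.2).ncard ≤ s.1.2.ncard := by
    rintro ⟨⟨S, Z⟩, ⟨x, hx⟩, _, _⟩
    obtain ⟨X, hXn, hXb⟩ := exists_balanced_separator hn Z
    refine ⟨insert x (X : Set V), ?_, ⟨x, Set.mem_insert _ _, hx⟩, fun v hv => ?_⟩
    · have := Set.ncard_insert_le x (X : Set V)
      rw [Set.ncard_coe_finset] at this
      omega
    · refine le_trans (Nat.mul_le_mul_left 2 (Set.ncard_le_ncard (Set.inter_subset_inter_left _
        (strongComp_anti (Set.subset_insert _ _))) (Set.toFinite _)))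
        (hXb v fun h => hv (Set.mem_insert_of_mem _ h))
  choose X hXn hXne hXb using hX
  -- The children are strong components of `G - (X ∪ Z)`. Of the old guard only the part in the same
  -- strong component of `G - X` is kept, at most half of it, so guards stay within `n + n`.
  let ch : σ → σ → Prop := fun s t => ∃ v ∈ s.1.1, v ∉ X s ∧
    t.1.1 = G.strongComp (X s ∪ s.1.2) v ∧ t.1.2 = X s ∪ (s.1.2 ∩ G.strongComp (X s) v)
  have hnotZ : ∀ s : σ, ∀ v ∈ s.1.1, v ∉ X s → v ∉ X s ∪ s.1.2 := fun s v hv hvX h =>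
    h.elim hvX (Set.disjoint_left.1 s.2.2.1.1 hv)
  have hsub : ∀ s : σ, ∀ v ∈ s.1.1, v ∉ X s → ∀ u ∈ G.strongComp (X s ∪ s.1.2) v,
      u ∈ s.1.1 ∧ u ∉ X s := by
    intro s v hv hvX u hu
    have hu' := notMem_of_mem_strongComp (hnotZ s v hv hvX) hu
    refine ⟨?_, fun h => hu' (Or.inl h)⟩
    by_contra hus
    exact s.2.2.1.2 v hv v hv u (fun h => h.elim hus fun h => hu' (Or.inr h))
      ⟨deleteVerts_reach_mono Set.subset_union_right hu.1,
        deleteVerts_reach_mono Set.subset_union_right hu.2⟩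
  have hchild : ∀ s : σ, ∀ v ∈ s.1.1, v ∉ X s → ∃ t : σ,
      t.1.1 = G.strongComp (X s ∪ s.1.2) v ∧
      t.1.2 = X s ∪ (s.1.2 ∩ G.strongComp (X s) v) := by
    intro s v hv hvX
    have hanti : G.strongComp (X s ∪ s.1.2) v ⊆ G.strongComp (X s) v :=
      strongComp_anti Set.subset_union_left
    refine ⟨⟨(G.strongComp (X s ∪ s.1.2) v, X s ∪ (s.1.2 ∩ G.strongComp (X s) v)),
      ⟨v, mem_strongComp_self⟩, ⟨?_, ?_⟩, ?_⟩, rfl, rfl⟩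
    · refine Set.disjoint_left.2 fun u hu hu' => ?_
      exact notMem_of_mem_strongComp (hnotZ s v hv hvX) hu
        (hu'.imp id fun h => h.1)
    · rintro a ha c hc b hb ⟨hab, hbc⟩
      have hXsub : X s ⊆ X s ∪ (s.1.2 ∩ G.strongComp (X s) v) := Set.subset_union_left
      -- A walk that leaves the child and returns avoids `X`, so it stays in the strong component of
      -- `G - X`. There, avoiding the new guard means avoiding all of `Z`.
      have key : ∀ x y, ((G.deleteVerts (X s ∪ (s.1.2 ∩ G.strongComp (X s) v))).Adj x y ∧
          x ∈ G.strongComp (X s) v ∧ y ∈ G.strongComp (X s) v) →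
          (G.deleteVerts (X s ∪ s.1.2)).Adj x y := by
        rintro x y ⟨⟨h1, h2, h3⟩, h4, h5⟩
        exact ⟨h1, fun h => h2 (h.imp id fun h => ⟨h, h4⟩), fun h => h3 (h.imp id fun h => ⟨h, h5⟩)⟩
      have h1 := reflTransGen_in_strongComp hXsub (hanti ha) (hanti hc) hab hbc
      have hbK : b ∈ G.strongComp (X s) v :=
        ⟨(hanti ha).1.trans (deleteVerts_reach_mono hXsub hab),
          (deleteVerts_reach_mono hXsub hbc).trans (hanti hc).2⟩
      have h2 := reflTransGen_in_strongComp hXsub hbK (hanti hc) hbc ReflTransGen.refl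
      exact hb (Or.inl ⟨ha.1.trans (ReflTransGen.mono key _ _ h1),
        (ReflTransGen.mono key _ _ h2).trans hc.2⟩)
    · have h1 := Set.ncard_union_le (X s) (s.1.2 ∩ G.strongComp (X s) v)
      have h2 := hXn s
      have h3 := hXb s v hvX
      have h4 := s.2.2.2
      rw [Set.inter_comm] at h3
      simp only []
      omega
  let root : σ := ⟨(Set.univ, ∅), Set.univ_nonempty, ⟨Set.disjoint_empty _, fun _ _ _ _ b hb _ =>
    hb (Or.inl (Set.mem_univ b))⟩, by simp⟩
  refine exists_widthLE_of_branching root (fun s => s.1.1) (fun s => X s ∩ s.1.1) (fun s => s.1.2) ch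
    _ rfl hXne (fun s => Set.inter_subset_right) ?_ ?_ ?_ (fun _ t _ => t.2.2.1) ?_
  · rintro s t ⟨v, hv, hvX, h1, -⟩ u hu
    simp only [h1] at hu
    exact ⟨(hsub s v hv hvX u hu).1, fun h => (hsub s v hv hvX u hu).2 h.1⟩
  · intro s v hv hvW
    have hvX : v ∉ X s := fun h => hvW ⟨h, hv⟩
    obtain ⟨t, h1, h2⟩ := hchild s v hv hvX
    refine ⟨t, ⟨v, hv, hvX, h1, h2⟩, ?_⟩
    simp only [h1]
    exact mem_strongComp_self
  · rintro s t t' ⟨v, hv, hvX, h1, h2⟩ ⟨v', hv', hvX', h1', h2'⟩ x hx hx'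
    simp only [h1] at hx
    simp only [h1'] at hx'
    have e1 := (strongComp_eq hx).symm.trans (strongComp_eq hx')
    have e2 := (strongComp_eq (strongComp_anti Set.subset_union_left hx)).symm.trans
      (strongComp_eq (strongComp_anti Set.subset_union_left hx'))
    refine Subtype.ext (Prod.ext ?_ ?_)
    · rw [h1, h1', e1]
    · rw [h2, h2', e2]
  · intro s
    refine ⟨X s ∪ s.1.2, ?_, fun x hx => Or.inl hx.1, Set.subset_union_right, ?_⟩
    · have h1 := Set.ncard_union_le (X s) s.1.2
      have h2 := hXn s
      have h4 := s.2.2.2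
      omega
    · rintro t ⟨v, _, _, _, h2⟩
      simp only [h2]
      exact Set.union_subset_union_right _ Set.inter_subset_left

end StrongComp

theorem HasCyclePacking.mono {G : Digraph V} {p q k : ℕ} (hpq : p ≤ q)
    (h : G.HasCyclePacking p k) : G.HasCyclePacking q k := by
  obtain ⟨F, h1, h2, h3⟩ := h
  exact ⟨F, h1, h2, fun v => (h3 v).trans hpq⟩

end Digraph

theorem theorem2 :
    (∃ c : ℕ, ∀ (V : Type u) [Finite V] (G : Digraph V) (k : ℕ),
      ¬ G.HasCyclePacking 4 k → G.directedTreewidth ≤ c * k ^ 3) ∧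
    (∃ c : ℕ, ∀ (V : Type u) [Finite V] (G : Digraph V) (k : ℕ),
      ¬ G.HasCyclePacking 3 k → G.directedTreewidth ≤ c * k ^ 4) ∧
    (∃ c : ℕ, ∀ (V : Type u) [Finite V] (G : Digraph V) (k : ℕ),
      ¬ G.HasCyclePacking 2 k → G.directedTreewidth ≤ c * k ^ 5) := by
  -- A fourth power already suffices for congestion 2. It gives the case of congestion 3 by
  -- monotonicity and implies the fifth power.
  have half : ∀ (V : Type u) [Finite V] (G : Digraph V) (k : ℕ),
      ¬ G.HasCyclePacking 2 k → G.directedTreewidth ≤ 3 * (2176 * k ^ 4) := by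
    intro V _ G k h
    cases nonempty_fintype V
    exact Digraph.directedTreewidth_le_of_forall_not_isBramble fun _ hB =>
      h hB.hasCyclePacking_two
  refine ⟨⟨3 * 12544, fun V _ G k h => ?_⟩, ⟨3 * 2176, fun V _ G k h => ?_⟩,
    ⟨3 * 2176, fun V _ G k h => ?_⟩⟩
  · cases nonempty_fintype V
    rw [mul_assoc]
    exact Digraph.directedTreewidth_le_of_forall_not_isBramble fun _ hB =>
      h hB.hasCyclePacking_four
  · rw [mul_assoc]
    exact half V G k fun h' => h (h'.mono (by omega))
  · rw [mul_assoc]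
    refine (half V G k h).trans (Nat.mul_le_mul_left _ (Nat.mul_le_mul_left _ ?_))
    rcases Nat.eq_zero_or_pos k with rfl | hk
    · simp
    · exact Nat.pow_le_pow_right hk (by omega)
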